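/- \textbf{Definitions.} Boolean algebras have operations $\vee,\wedge,{}^*$ and may satisfy $0=1$. A \emph{contact relation} on a Boolean algebra $B$ is a relation $C$ such that: $a\ne 0\Rightarrow aCa$; $aCb\Rightarrow a\neq 0\neq b$; $aCb\Rightarrow bCa$; $aC(b\vee c)\Leftrightarrow (aCb$ or $aCc)$. Write $a\ll_C b$ if not $aCb^*$. A \emph{complete local contact algebra} (CLCA) is a triple $(B,\rho,\mathbb B)$ where $B$ is a complete Boolean algebra, $\rho$ is a contact relation on $B$, and $\mathbb B\subseteq B$ contains $0$, is closed downwards and under $\vee$, and satisfies: if $a\in\mathbb B$ and $a\ll_\rho c$, then $a\ll_\rho b\ll_\rho c$ for some $b\in\mathbb B$; if $a\rho b$, then $a\rho(c\wedge b)$ for some $c\in\mathbb B$; if $a\neq0$, then $b\ll_\rho a$ for some $b\in\mathbb B\setminus\{0\}$. A \emph{complete MVD-algebra} is a triple $(B,\le,\ll)$ where $(B,\le)$ is a complete Boolean algebra and $\ll$ is a binary relation on $B$ such that: $a\ll b\Rightarrow a\le b$; $0\ll0$; $a\le b\ll c\le t\Rightarrow a\ll t$; $a\ll c,\ b\ll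 c\Rightarrow a\vee b\ll c$; $a\ll b,\ a\ll c\Rightarrow a\ll b\wedge c$; $a\ll c\Rightarrow a\ll b\ll c$ for some $b$; if $a\ne0$ there is $b\neq0$ with $b\ll a$; if $a\ll1$ and $b^*\ll a^*$, then $a\ll b$. A \emph{complete Boolean homomorphism} $\varphi:A\to B$ is a Boolean homomorphism preserving all joins and meets; $\varphi_\Lambda:B\to A$ is its lower adjoint: $b\le\varphi(a)\Leftrightarrow\varphi_\Lambda(b)\le a$. In each of the following categories composition is the usual composition of functions. \begin{itemize} \item A \emph{SAL-morphism} $\varphi:(A,\rho,\mathbb B)\to(B,\eta,\mathbb B')$ between CLCAs is a complete Boolean homomorphism $A\to B$ with (L1) $\varphi(a)\,\eta\,\varphi(b)\Rightarrow a\rho b$ for all $a,b\in A$; (L2) $b\in\mathbb B'\Rightarrow\varphi_\Lambda(b)\in\mathbb B$; (L3) $a\in\mathbb B\Rightarrow\varphi(a)\in\mathbb B'$. The objects of $\mathbf{ISAL}$ and of $\mathbf{SSAL}$ are all CLCAs. The morphisms of $\mathbf{ISAL}$ are the injective SAL-morphisms; those of $\mathbf{SSAL}$ are the SAL-morphisms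 satisfying (LS): for all $a,b\in\mathbb B'$, $\varphi_\Lambda(a)\,\rho\,\varphi_\Lambda(b)\Rightarrow a\eta b$. \item An \emph{IA-morphism} $\varphi:(B,\le,\ll)\to(B',\le',\ll')$ between complete MVD-algebras is a complete Boolean homomorphism $B\to B'$ with (ES1) $a\ll b\Rightarrow\varphi(a)\ll'\varphi(b)$ for all $a,b\in B$; (S2) $b\ll'1\Rightarrow\varphi_\Lambda(b)\ll1$ for all $b\in B'$; (S3) $a\ll1\Rightarrow\varphi(a)\ll'1$ for all $a\in B$. The objects of $\mathbf{IIA}$ and of $\mathbf{SIA}$ are all complete MVD-algebras. The morphisms of $\mathbf{IIA}$ are the injective IA-morphisms; those of $\mathbf{SIA}$ are the IA-morphisms satisfying (CS): for all $a,b\in B'$, $a\ll'b\Rightarrow\varphi_\Lambda(a)\ll(\varphi_\Lambda(b^*))^*$. \item A map $f:X\to Y$ of topological spaces is \emph{skeletal} if $\operatorname{int}(\operatorname{cl}(f(U)))\ne\emptyset$ for every non-empty open $U\subseteq X$, and \emph{perfect} if it is continuous and closed with compact point inverses. The objects of $\mathbf{SSLC}$ and of $\mathbf{ISLC}$ are all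 locally compact Hausdorff spaces; the morphisms are the surjective (respectively injective) skeletal perfect maps. \end{itemize} \textbf{Theorem.} (i) The categories $\mathbf{ISAL}$ and $\mathbf{IIA}$ are isomorphic, and the categories $\mathbf{SSLC}$ and $\mathbf{IIA}$ are dually equivalent. (ii) The categories $\mathbf{SSAL}$ and $\mathbf{SIA}$ are isomorphic, and the categories $\mathbf{ISLC}$ and $\mathbf{SIA}$ are dually equivalent. -/

import Mathlib

open CategoryTheory

universe u

namespace RegionBased

/-! ### Contact algebras, local contact algebras, MVD-algebras -/

/-- `C` is a contact relation on the Boolean algebra `B`. -/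
structure IsContact {B : Type u} [BooleanAlgebra B] (C : B → B → Prop) : Prop where
  refl_of_ne_bot : ∀ a, a ≠ ⊥ → C a a
  ne_bot : ∀ a b, C a b → a ≠ ⊥ ∧ b ≠ ⊥
  symm : ∀ a b, C a b → C b a
  sup_iff : ∀ a b c, C a (b ⊔ c) ↔ C a b ∨ C a c

/-- The non-tangential inclusion `a ≪_C b` associated with a relation `C`. -/
def NonTang {B : Type u} [BooleanAlgebra B] (C : B → B → Prop) (a b : B) : Prop :=
  ¬ C a bᶜ

/-- `(B, ρ, bdd)` is a local contact algebra; `bdd` is the set of bounded elements. -/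
structure IsLocalContact {B : Type u} [BooleanAlgebra B] (ρ : B → B → Prop) (bdd : Set B) : Prop
    extends IsContact ρ where
  bot_mem : ⊥ ∈ bdd
  mem_of_le : ∀ a b, a ≤ b → b ∈ bdd → a ∈ bdd
  sup_mem : ∀ a b, a ∈ bdd → b ∈ bdd → a ⊔ b ∈ bdd
  interpolate : ∀ a c, a ∈ bdd → NonTang ρ a c → ∃ b ∈ bdd, NonTang ρ a b ∧ NonTang ρ b c
  contact_bdd : ∀ a b, ρ a b → ∃ c ∈ bdd, ρ a (c ⊓ b)
  exists_nonTang : ∀ a, a ≠ ⊥ → ∃ b ∈ bdd, b ≠ ⊥ ∧ NonTang ρ b a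

/-- `(B, ≤, ll)` is an MVD-algebra. -/
structure IsMVD {B : Type u} [BooleanAlgebra B] (ll : B → B → Prop) : Prop where
  le_of_ll : ∀ a b, ll a b → a ≤ b
  bot_ll : ll ⊥ ⊥
  mono : ∀ a b c t, a ≤ b → ll b c → c ≤ t → ll a t
  sup_ll : ∀ a b c, ll a c → ll b c → ll (a ⊔ b) c
  ll_inf : ∀ a b c, ll a b → ll a c → ll a (b ⊓ c)
  interpolate : ∀ a c, ll a c → ∃ b, ll a b ∧ ll b c
  exists_ll : ∀ a, a ≠ ⊥ → ∃ b, b ≠ ⊥ ∧ ll b a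
  ll_of_compl : ∀ a b, ll a ⊤ → ll bᶜ aᶜ → ll a b

/-- Complete local contact algebras. -/
structure CLCA : Type (u + 1) where
  carrier : Type u
  [inst : CompleteBooleanAlgebra carrier]
  ρ : carrier → carrier → Prop
  bdd : Set carrier
  isLocalContact : IsLocalContact ρ bdd

attribute [instance] CLCA.inst

/-- Complete MVD-algebras. -/
structure CMVD : Type (u + 1) where
  carrier : Type u
  [inst : CompleteBooleanAlgebra carrier]
  ll : carrier → carrier → Prop
  isMVD : IsMVD ll

attribute [instance] CMVD.inst

/-! ### Lower adjoints

A complete Boolean homomorphism is a map preserving all suprema and infima, i.e. a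
`CompleteLatticeHom` (preservation of complements is automatic). -/

/-- The lower adjoint `φ_Λ` of a complete Boolean homomorphism. -/
def lowerAdj {A B : Type u} [CompleteBooleanAlgebra A] [CompleteBooleanAlgebra B]
    (φ : CompleteLatticeHom A B) (b : B) : A :=
  sInf {a | b ≤ φ a}

theorem gc_lowerAdj {A B : Type u} [CompleteBooleanAlgebra A] [CompleteBooleanAlgebra B]
    (φ : CompleteLatticeHom A B) : GaloisConnection (lowerAdj φ) φ := by
  intro b a
  constructor
  · intro h
    have h1 : b ≤ φ (lowerAdj φ b) := by
      unfold lowerAdj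
      rw [map_sInf]
      apply le_sInf
      rintro _ ⟨x, hx, rfl⟩
      exact hx
    exact h1.trans (OrderHomClass.mono φ h)
  · intro h
    exact sInf_le h

theorem lowerAdj_id {A : Type u} [CompleteBooleanAlgebra A] (a : A) :
    lowerAdj (CompleteLatticeHom.id A) a = a := by
  refine le_antisymm ((gc_lowerAdj (CompleteLatticeHom.id A) a a).2 le_rfl) ?_
  exact (gc_lowerAdj (CompleteLatticeHom.id A)).le_u_l a

theorem lowerAdj_comp {A B C : Type u} [CompleteBooleanAlgebra A] [CompleteBooleanAlgebra B]
    [CompleteBooleanAlgebra C] (ψ : CompleteLatticeHom B C) (φ : CompleteLatticeHom A B) (c : C) :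
    lowerAdj (ψ.comp φ) c = lowerAdj φ (lowerAdj ψ c) := by
  apply eq_of_forall_ge_iff
  intro a
  rw [gc_lowerAdj (ψ.comp φ) c a, gc_lowerAdj φ _ a, gc_lowerAdj ψ c _]
  rfl

/-! ### Morphism conditions for complete local contact algebras -/

/-- SAL-morphisms: conditions (L1), (L2), (L3). -/
structure IsSAL {A B : CLCA.{u}} (φ : CompleteLatticeHom A.carrier B.carrier) : Prop where
  l1 : ∀ a b, B.ρ (φ a) (φ b) → A.ρ a b
  l2 : ∀ b ∈ B.bdd, lowerAdj φ b ∈ A.bdd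
  l3 : ∀ a ∈ A.bdd, φ a ∈ B.bdd

/-- Condition (LS). -/
def CondLS {A B : CLCA.{u}} (φ : CompleteLatticeHom A.carrier B.carrier) : Prop :=
  ∀ a ∈ B.bdd, ∀ b ∈ B.bdd, A.ρ (lowerAdj φ a) (lowerAdj φ b) → B.ρ a b

theorem IsSAL.id (A : CLCA.{u}) : IsSAL (A := A) (B := A) (CompleteLatticeHom.id A.carrier) where
  l1 _ _ h := h
  l2 b hb := by rwa [lowerAdj_id]
  l3 _ h := h

theorem IsSAL.comp {A B C : CLCA.{u}} {ψ : CompleteLatticeHom B.carrier C.carrier}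
    {φ : CompleteLatticeHom A.carrier B.carrier} (hψ : IsSAL ψ) (hφ : IsSAL φ) :
    IsSAL (A := A) (B := C) (ψ.comp φ) where
  l1 a b h := hφ.l1 a b (hψ.l1 _ _ h)
  l2 b hb := by
    rw [lowerAdj_comp]
    exact hφ.l2 _ (hψ.l2 _ hb)
  l3 a ha := hψ.l3 _ (hφ.l3 _ ha)

theorem CondLS.id (A : CLCA.{u}) :
    CondLS (A := A) (B := A) (CompleteLatticeHom.id A.carrier) := by
  intro a _ b _ h
  rwa [lowerAdj_id, lowerAdj_id] at h

theorem CondLS.comp {A B C : CLCA.{u}} {ψ : CompleteLatticeHom B.carrier C.carrier}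
    {φ : CompleteLatticeHom A.carrier B.carrier} (hψ : CondLS ψ) (hφ : CondLS φ)
    (h2 : IsSAL ψ) : CondLS (A := A) (B := C) (ψ.comp φ) := by
  intro a ha b hb h
  rw [lowerAdj_comp, lowerAdj_comp] at h
  exact hψ a ha b hb (hφ _ (h2.l2 _ ha) _ (h2.l2 _ hb) h)

/-! ### Morphism conditions for complete MVD-algebras -/

/-- IA-morphisms: conditions (ES1), (S2), (S3). -/
structure IsIA {A B : CMVD.{u}} (φ : CompleteLatticeHom A.carrier B.carrier) : Prop where
  es1 : ∀ a b, A.ll a b → B.ll (φ a) (φ b)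
  s2 : ∀ b, B.ll b ⊤ → A.ll (lowerAdj φ b) ⊤
  s3 : ∀ a, A.ll a ⊤ → B.ll (φ a) ⊤

/-- Condition (CS). -/
def CondCS {A B : CMVD.{u}} (φ : CompleteLatticeHom A.carrier B.carrier) : Prop :=
  ∀ a b, B.ll a b → A.ll (lowerAdj φ a) (lowerAdj φ bᶜ)ᶜ

theorem IsIA.id (A : CMVD.{u}) : IsIA (A := A) (B := A) (CompleteLatticeHom.id A.carrier) where
  es1 _ _ h := h
  s2 b hb := by rwa [lowerAdj_id]
  s3 _ h := h

theorem IsIA.comp {A B C : CMVD.{u}} {ψ : CompleteLatticeHom B.carrier C.carrier}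
    {φ : CompleteLatticeHom A.carrier B.carrier} (hψ : IsIA ψ) (hφ : IsIA φ) :
    IsIA (A := A) (B := C) (ψ.comp φ) where
  es1 a b h := hψ.es1 _ _ (hφ.es1 a b h)
  s2 b hb := by
    rw [lowerAdj_comp]
    exact hφ.s2 _ (hψ.s2 _ hb)
  s3 a ha := hψ.s3 _ (hφ.s3 _ ha)

theorem CondCS.id (A : CMVD.{u}) :
    CondCS (A := A) (B := A) (CompleteLatticeHom.id A.carrier) := by
  intro a b h
  rwa [lowerAdj_id, lowerAdj_id, compl_compl]

theorem CondCS.comp {A B C : CMVD.{u}} {ψ : CompleteLatticeHom B.carrier C.carrier}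
    {φ : CompleteLatticeHom A.carrier B.carrier} (hψ : CondCS ψ) (hφ : CondCS φ) :
    CondCS (A := A) (B := C) (ψ.comp φ) := by
  intro a b h
  rw [lowerAdj_comp, lowerAdj_comp]
  have := hφ _ _ (hψ a b h)
  rwa [compl_compl] at this

/-! ### The four categories of algebras -/

/-- Objects of the category of complete local contact algebras and injective SAL-morphisms. -/
structure ISAL : Type (u + 1) extends CLCA.{u}

/-- Injective complete Boolean homomorphisms satisfying (L1), (L2), (L3). -/
@[ext]
structure ISAL.Hom (A B : ISAL.{u}) : Type u where
  map : CompleteLatticeHom A.carrier B.carrier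
  injective : Function.Injective map
  isSAL : IsSAL (A := A.toCLCA) (B := B.toCLCA) map

instance : Category.{u} ISAL.{u} where
  Hom A B := ISAL.Hom A B
  id A := ⟨CompleteLatticeHom.id A.carrier, fun _ _ h => h, IsSAL.id A.toCLCA⟩
  comp f g := ⟨g.map.comp f.map, g.injective.comp f.injective, g.isSAL.comp f.isSAL⟩

/-- Objects of the category of complete local contact algebras and SAL-morphisms with (LS). -/
structure SSAL : Type (u + 1) extends CLCA.{u}

/-- SAL-morphisms satisfying (LS). -/
@[ext]
structure SSAL.Hom (A B : SSAL.{u}) : Type u where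
  map : CompleteLatticeHom A.carrier B.carrier
  isSAL : IsSAL (A := A.toCLCA) (B := B.toCLCA) map
  condLS : CondLS (A := A.toCLCA) (B := B.toCLCA) map

instance : Category.{u} SSAL.{u} where
  Hom A B := SSAL.Hom A B
  id A := ⟨CompleteLatticeHom.id A.carrier, IsSAL.id A.toCLCA, CondLS.id A.toCLCA⟩
  comp f g := ⟨g.map.comp f.map, g.isSAL.comp f.isSAL, g.condLS.comp f.condLS g.isSAL⟩

/-- Objects of the category of complete MVD-algebras and injective IA-morphisms. -/
structure IIA : Type (u + 1) extends CMVD.{u}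

/-- Injective complete Boolean homomorphisms satisfying (ES1), (S2), (S3). -/
@[ext]
structure IIA.Hom (A B : IIA.{u}) : Type u where
  map : CompleteLatticeHom A.carrier B.carrier
  injective : Function.Injective map
  isIA : IsIA (A := A.toCMVD) (B := B.toCMVD) map

instance : Category.{u} IIA.{u} where
  Hom A B := IIA.Hom A B
  id A := ⟨CompleteLatticeHom.id A.carrier, fun _ _ h => h, IsIA.id A.toCMVD⟩
  comp f g := ⟨g.map.comp f.map, g.injective.comp f.injective, g.isIA.comp f.isIA⟩

/-- Objects of the category of complete MVD-algebras and IA-morphisms with (CS). -/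
structure SIA : Type (u + 1) extends CMVD.{u}

/-- IA-morphisms satisfying (CS). -/
@[ext]
structure SIA.Hom (A B : SIA.{u}) : Type u where
  map : CompleteLatticeHom A.carrier B.carrier
  isIA : IsIA (A := A.toCMVD) (B := B.toCMVD) map
  condCS : CondCS (A := A.toCMVD) (B := B.toCMVD) map

instance : Category.{u} SIA.{u} where
  Hom A B := SIA.Hom A B
  id A := ⟨CompleteLatticeHom.id A.carrier, IsIA.id A.toCMVD, CondCS.id A.toCMVD⟩
  comp f g := ⟨g.map.comp f.map, g.isIA.comp f.isIA, g.condCS.comp f.condCS⟩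

/-! ### The two categories of locally compact Hausdorff spaces -/

/-- Locally compact Hausdorff spaces. -/
structure LCHaus : Type (u + 1) where
  carrier : Type u
  [top : TopologicalSpace carrier]
  [locallyCompact : LocallyCompactSpace carrier]
  [t2 : T2Space carrier]

attribute [instance] LCHaus.top LCHaus.locallyCompact LCHaus.t2

/-- Skeletal maps. -/
def IsSkeletal {X Y : Type u} [TopologicalSpace X] [TopologicalSpace Y] (f : X → Y) : Prop :=
  ∀ U : Set X, IsOpen U → U.Nonempty → (interior (closure (f '' U))).Nonempty

/-- Perfect maps: continuous closed maps with compact point inverses. -/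
structure IsPerfectMap {X Y : Type u} [TopologicalSpace X] [TopologicalSpace Y] (f : X → Y) :
    Prop where
  continuous : Continuous f
  isClosedMap : IsClosedMap f
  isCompact_fiber : ∀ y, IsCompact (f ⁻¹' {y})

theorem isPerfectMap_iff_isProperMap {X Y : Type u} [TopologicalSpace X] [TopologicalSpace Y]
    (f : X → Y) : IsPerfectMap f ↔ IsProperMap f := by
  rw [isProperMap_iff_isClosedMap_and_compact_fibers]
  exact ⟨fun h => ⟨h.1, h.2, h.3⟩, fun h => ⟨h.1, h.2.1, h.2.2⟩⟩

/-- Skeletal perfect maps. -/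
structure IsSkelPerfect {X Y : Type u} [TopologicalSpace X] [TopologicalSpace Y] (f : X → Y) :
    Prop where
  isSkeletal : IsSkeletal f
  isPerfectMap : IsPerfectMap f

theorem IsSkelPerfect.id (X : Type u) [TopologicalSpace X] : IsSkelPerfect (id : X → X) where
  isSkeletal U hU hne := by
    rw [Set.image_id]
    exact hne.mono (interior_maximal subset_closure hU)
  isPerfectMap := (isPerfectMap_iff_isProperMap _).2 isProperMap_id

theorem IsSkelPerfect.comp {X Y Z : Type u} [TopologicalSpace X] [TopologicalSpace Y]
    [TopologicalSpace Z] {g : Y → Z} {f : X → Y} (hg : IsSkelPerfect g) (hf : IsSkelPerfect f) :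
    IsSkelPerfect (g ∘ f) where
  isSkeletal U hU hne := by
    have h := hg.isSkeletal _ isOpen_interior (hf.isSkeletal U hU hne)
    refine h.mono (interior_mono ?_)
    refine closure_minimal ?_ isClosed_closure
    rw [Set.image_comp]
    exact (Set.image_mono interior_subset).trans
      (image_closure_subset_closure_image hg.isPerfectMap.continuous)
  isPerfectMap := (isPerfectMap_iff_isProperMap _).2
    (((isPerfectMap_iff_isProperMap _).1 hg.isPerfectMap).comp
      ((isPerfectMap_iff_isProperMap _).1 hf.isPerfectMap))

/-- Objects of the category of locally compact Hausdorff spaces and surjective skeletal perfect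
maps. -/
structure SSLC : Type (u + 1) extends LCHaus.{u}

/-- Surjective skeletal perfect maps. -/
@[ext]
structure SSLC.Hom (X Y : SSLC.{u}) : Type u where
  map : X.carrier → Y.carrier
  surjective : Function.Surjective map
  isSkelPerfect : IsSkelPerfect map

instance : Category.{u} SSLC.{u} where
  Hom X Y := SSLC.Hom X Y
  id X := ⟨id, Function.surjective_id, IsSkelPerfect.id X.carrier⟩
  comp f g := ⟨g.map ∘ f.map, g.surjective.comp f.surjective,
    g.isSkelPerfect.comp f.isSkelPerfect⟩

/-- Objects of the category of locally compact Hausdorff spaces and injective skeletal perfect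
maps. -/
structure ISLC : Type (u + 1) extends LCHaus.{u}

/-- Injective skeletal perfect maps. -/
@[ext]
structure ISLC.Hom (X Y : ISLC.{u}) : Type u where
  map : X.carrier → Y.carrier
  injective : Function.Injective map
  isSkelPerfect : IsSkelPerfect map

instance : Category.{u} ISLC.{u} where
  Hom X Y := ISLC.Hom X Y
  id X := ⟨id, Function.injective_id, IsSkelPerfect.id X.carrier⟩
  comp f g := ⟨g.map ∘ f.map, g.injective.comp f.injective,
    g.isSkelPerfect.comp f.isSkelPerfect⟩

/-! ### Isomorphism and dual equivalence of categories -/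

/-- Two categories are isomorphic if there are mutually inverse functors between them. -/
def IsomorphicCategories (C D : Type (u + 1)) [Category.{u} C] [Category.{u} D] : Prop :=
  ∃ (F : C ⥤ D) (G : D ⥤ C), F ⋙ G = 𝟭 C ∧ G ⋙ F = 𝟭 D

/-- Two categories are dually equivalent if the opposite of the first is equivalent to the
second. -/
def DuallyEquivalent (C D : Type (u + 1)) [Category.{u} C] [Category.{u} D] : Prop :=
  Nonempty (Cᵒᵖ ≌ D)

end RegionBased

namespace RegionBased

/-! ### Monotonicity of contact relations -/

section Contact

variable {B : Type u} [BooleanAlgebra B] {ρ : B → B → Prop}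

/-! Algebraic half. On a fixed Boolean algebra, local contact structures and MVD-relations determine
each other. From `(ρ, bdd)` put `a ≪ b` when `a` is bounded and not in contact with `bᶜ`. From `≪`
call `a` bounded when `a ≪ ⊤`, and let `a`, `b` be in contact when some bounded `c ≤ a`, `d ≤ b`
fail `c ≪ dᶜ`. The round trips are equalities because contact is always witnessed by bounded parts
(`IsLocalContact.exists_bdd`) and because `≪` can be read off the induced contact
(`IsMVD.not_llContact`). The morphism conditions translate with the same underlying homomorphism, so
the categories are strictly isomorphic.

Topological half. A space `X` goes to its regular open sets, with `U ≪ V` when `closure U` is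
compact and contained in `V`; a map `f` goes to `V ↦ int (cl (f⁻¹ V))`. Skeletality makes this a
complete homomorphism (`IsSkeletal.preimage_subset`). Surjectivity of `f` corresponds to injectivity
of the homomorphism, and injectivity of `f` to (CS). The functor is faithful because `f x ∈ V` holds
iff `x` lies in the pullback of some `W ≪ V`. It is full because an IA-morphism pulls ends (maximal
round filters) back to ends, and the ends of the algebra of regular open sets are exactly the points
(`IsEnd.exists_point`, `IsIA.exists_map`). It is essentially surjective because a complete
MVD-algebra is the algebra of regular open sets of its space of ends (`CMVD.basicRO_surjective`,
`CMVD.roLL_basicRO_iff`). -/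

theorem IsContact.mono_right (h : IsContact ρ) {a b c : B} (hab : ρ a b) (hbc : b ≤ c) :
    ρ a c := by
  rw [← sup_eq_right.2 hbc]
  exact (h.sup_iff _ _ _).2 (Or.inl hab)

theorem IsContact.mono (h : IsContact ρ) {a b c d : B} (hab : ρ a b) (hac : a ≤ c)
    (hbd : b ≤ d) : ρ c d :=
  h.symm _ _ (h.mono_right (h.symm _ _ (h.mono_right hab hbd)) hac)

theorem IsContact.of_inf_ne_bot (h : IsContact ρ) {a b : B} (hab : a ⊓ b ≠ ⊥) : ρ a b :=
  h.mono (h.refl_of_ne_bot _ hab) inf_le_left inf_le_right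

theorem IsContact.not_bot_right (h : IsContact ρ) (a : B) : ¬ ρ a ⊥ :=
  fun hab => (h.ne_bot _ _ hab).2 rfl

theorem IsContact.not_bot_left (h : IsContact ρ) (a : B) : ¬ ρ ⊥ a :=
  fun hab => (h.ne_bot _ _ hab).1 rfl

/-- Two elements in contact have bounded parts in contact. -/
theorem IsLocalContact.exists_bdd {bdd : Set B} (h : IsLocalContact ρ bdd) {a b : B}
    (hab : ρ a b) : ∃ c ∈ bdd, ∃ d ∈ bdd, c ≤ a ∧ d ≤ b ∧ ρ c d := by
  obtain ⟨d, hd, h1⟩ := h.contact_bdd a b hab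
  obtain ⟨c, hc, h2⟩ := h.contact_bdd _ _ (h.symm _ _ h1)
  exact ⟨c ⊓ a, h.mem_of_le _ _ inf_le_left hc, d ⊓ b, h.mem_of_le _ _ inf_le_left hd,
    inf_le_right, inf_le_right, h.symm _ _ h2⟩

/-- The bounded non-tangential inclusion of a local contact algebra. -/
def bddLL (ρ : B → B → Prop) (bdd : Set B) (a b : B) : Prop :=
  a ∈ bdd ∧ NonTang ρ a b

theorem IsLocalContact.isMVD {bdd : Set B} (h : IsLocalContact ρ bdd) : IsMVD (bddLL ρ bdd) where
  le_of_ll a b hab := by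
    by_contra hle
    exact hab.2 (h.of_inf_ne_bot fun h0 => hle (disjoint_compl_right_iff.1 (disjoint_iff.2 h0)))
  bot_ll := ⟨h.bot_mem, h.not_bot_left _⟩
  mono a b c t hab hbc hct :=
    ⟨h.mem_of_le _ _ hab hbc.1, fun hat => hbc.2 (h.mono hat hab (compl_le_compl hct))⟩
  sup_ll a b c hac hbc := ⟨h.sup_mem _ _ hac.1 hbc.1, fun hc =>
    ((h.sup_iff _ _ _).1 (h.symm _ _ hc)).elim (fun h1 => hac.2 (h.symm _ _ h1))
      (fun h1 => hbc.2 (h.symm _ _ h1))⟩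
  ll_inf a b c hab hac := ⟨hab.1, fun hc => by
    rw [compl_inf] at hc
    exact ((h.sup_iff _ _ _).1 hc).elim hab.2 hac.2⟩
  interpolate a c hac := by
    obtain ⟨b, hb, h1, h2⟩ := h.interpolate a c hac.1 hac.2
    exact ⟨b, ⟨hac.1, h1⟩, hb, h2⟩
  exists_ll a ha := by
    obtain ⟨b, hb, h1, h2⟩ := h.exists_nonTang a ha
    exact ⟨b, h1, hb, h2⟩
  ll_of_compl a b ha hab := ⟨ha.1, fun hc => hab.2 (by
    rw [compl_compl]
    exact h.symm _ _ hc)⟩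

theorem IsLocalContact.bddLL_top {bdd : Set B} (h : IsLocalContact ρ bdd) {a : B} :
    bddLL ρ bdd a ⊤ ↔ a ∈ bdd :=
  ⟨fun ha => ha.1, fun ha => ⟨ha, by
    rw [NonTang, compl_top]
    exact h.not_bot_right a⟩⟩

/-- The contact relation induced by an MVD-relation. -/
def llContact (ll : B → B → Prop) (a b : B) : Prop :=
  ∃ c ≤ a, ∃ d ≤ b, ll c ⊤ ∧ ll d ⊤ ∧ ¬ ll c dᶜ

variable {ll : B → B → Prop}

theorem IsMVD.ll_top (h : IsMVD ll) {a b : B} (hab : ll a b) : ll a ⊤ :=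
  h.mono _ _ _ _ le_rfl hab le_top

theorem IsMVD.bot_ll' (h : IsMVD ll) (a : B) : ll ⊥ a :=
  h.mono _ _ _ _ le_rfl h.bot_ll bot_le

theorem IsMVD.inf_ll_inf (h : IsMVD ll) {a b c d : B} (hab : ll a b) (hcd : ll c d) :
    ll (a ⊓ c) (b ⊓ d) :=
  h.ll_inf _ _ _ (h.mono _ _ _ _ inf_le_left hab le_rfl)
    (h.mono _ _ _ _ inf_le_right hcd le_rfl)

/-- The last MVD axiom in the form that makes the induced contact relation symmetric. -/
theorem IsMVD.ll_compl_comm (h : IsMVD ll) {a b : B} (hb : ll b ⊤) (hab : ll a bᶜ) : ll b aᶜ :=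
  h.ll_of_compl _ _ hb (by rwa [compl_compl])

/-- A bounded part of the complement is well inside the complement. -/
theorem IsMVD.compl_inf_ll_compl (h : IsMVD ll) {a b c : B} (hab : ll a b) (hc : ll c ⊤) :
    ll (bᶜ ⊓ c) aᶜ :=
  h.ll_compl_comm (h.mono _ _ _ _ inf_le_right hc le_rfl)
    (h.mono _ _ _ _ le_rfl hab (by rw [compl_inf, compl_compl]; exact le_sup_left))

/-- Contact tests only bounded parts of `bᶜ`. Nothing is lost for bounded `a`: with a bounded `e`
such that `a ≪ e`, it suffices to test `e ⊓ bᶜ`, since `e ⊓ (e ⊓ bᶜ)ᶜ ≤ b`. -/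
theorem IsMVD.not_llContact (h : IsMVD ll) {a b : B} (ha : ll a ⊤) :
    ¬ llContact ll a bᶜ ↔ ll a b := by
  constructor
  · intro hn
    obtain ⟨e, hae, he⟩ := h.interpolate a ⊤ ha
    have h1 : ll a (e ⊓ bᶜ)ᶜ := by
      by_contra hc
      exact hn ⟨a, le_rfl, e ⊓ bᶜ, inf_le_right, ha, h.mono _ _ _ _ inf_le_left he le_rfl, hc⟩
    refine h.mono _ _ _ _ le_rfl (h.ll_inf _ _ _ hae h1) ?_
    rw [compl_inf, compl_compl, inf_sup_left, inf_compl_self, bot_sup_eq]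
    exact inf_le_right
  · rintro hab ⟨c, hc, d, hd, -, -, hcd⟩
    exact hcd (h.mono _ _ _ _ hc hab (le_compl_comm.1 hd))

theorem IsMVD.isLocalContact (h : IsMVD ll) : IsLocalContact (llContact ll) {a | ll a ⊤} where
  refl_of_ne_bot a ha := by
    obtain ⟨b, hb, hba⟩ := h.exists_ll a ha
    refine ⟨b, h.le_of_ll _ _ hba, b, h.le_of_ll _ _ hba, h.ll_top hba, h.ll_top hba, fun hbb => ?_⟩
    exact hb (le_compl_self.1 (h.le_of_ll _ _ hbb))
  ne_bot := by
    rintro a b ⟨c, hc, d, hd, hc1, hd1, hcd⟩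
    refine ⟨?_, ?_⟩
    · rintro rfl
      exact hcd (by rw [le_bot_iff.1 hc]; exact h.bot_ll' _)
    · rintro rfl
      exact hcd (by rw [le_bot_iff.1 hd, compl_bot]; exact hc1)
  symm := by
    rintro a b ⟨c, hc, d, hd, hc1, hd1, hcd⟩
    exact ⟨d, hd, c, hc, hd1, hc1, fun hdc => hcd (h.ll_compl_comm hc1 hdc)⟩
  sup_iff a b c := by
    constructor
    · rintro ⟨x, hx, y, hy, hx1, hy1, hxy⟩
      by_contra! hn
      have hb : ll x (y ⊓ b)ᶜ := by
        by_contra hc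
        exact hn.1 ⟨x, hx, y ⊓ b, inf_le_right, hx1, h.mono _ _ _ _ inf_le_left hy1 le_rfl, hc⟩
      have hc : ll x (y ⊓ c)ᶜ := by
        by_contra hc
        exact hn.2 ⟨x, hx, y ⊓ c, inf_le_right, hx1, h.mono _ _ _ _ inf_le_left hy1 le_rfl, hc⟩
      -- Since `y ≤ b ⊔ c`, the two pieces `y ⊓ b` and `y ⊓ c` join to `y`.
      have := h.ll_inf _ _ _ hb hc
      rw [← compl_sup, ← inf_sup_left, inf_eq_left.2 hy] at this
      exact hxy this
    · rintro (⟨x, hx, y, hy, h1⟩ | ⟨x, hx, y, hy, h1⟩)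
      · exact ⟨x, hx, y, hy.trans le_sup_left, h1⟩
      · exact ⟨x, hx, y, hy.trans le_sup_right, h1⟩
  bot_mem := h.bot_ll' _
  mem_of_le a b hab hb := h.mono _ _ _ _ hab hb le_rfl
  sup_mem a b ha hb := h.sup_ll _ _ _ ha hb
  interpolate a c ha hac := by
    obtain ⟨b, hab, hbc⟩ := h.interpolate a c ((h.not_llContact ha).1 hac)
    exact ⟨b, h.ll_top hbc, (h.not_llContact ha).2 hab, (h.not_llContact (h.ll_top hbc)).2 hbc⟩
  contact_bdd := by
    rintro a b ⟨c, hc, d, hd, hc1, hd1, hcd⟩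
    exact ⟨d, hd1, c, hc, d, le_inf le_rfl hd, hc1, hd1, hcd⟩
  exists_nonTang a ha := by
    obtain ⟨b, hb, hba⟩ := h.exists_ll a ha
    exact ⟨b, h.ll_top hba, hb, (h.not_llContact (h.ll_top hba)).2 hba⟩

theorem IsMVD.bddLL_llContact (h : IsMVD ll) : bddLL (llContact ll) {a | ll a ⊤} = ll := by
  ext a b
  exact ⟨fun hab => (h.not_llContact hab.1).1 hab.2,
    fun hab => ⟨h.ll_top hab, (h.not_llContact (h.ll_top hab)).2 hab⟩⟩

theorem IsLocalContact.llContact_bddLL {bdd : Set B} (h : IsLocalContact ρ bdd) :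
    llContact (bddLL ρ bdd) = ρ := by
  ext a b
  constructor
  · rintro ⟨c, hc, d, hd, hc1, hd1, hcd⟩
    by_contra hn
    exact hcd ⟨hc1.1, fun hcd => hn (h.mono hcd hc (by rwa [compl_compl]))⟩
  · intro hab
    obtain ⟨c, hc, d, hd, hca, hdb, hcd⟩ := h.exists_bdd hab
    refine ⟨c, hca, d, hdb, h.bddLL_top.2 hc, h.bddLL_top.2 hd, fun hn => hn.2 ?_⟩
    rwa [compl_compl]

end Contact

/-! ### The passage between complete local contact algebras and complete MVD-algebras -/

/-- The complete MVD-algebra of a complete local contact algebra. -/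
def CLCA.toCMVD (A : CLCA.{u}) : CMVD.{u} :=
  ⟨A.carrier, bddLL A.ρ A.bdd, A.isLocalContact.isMVD⟩

/-- The complete local contact algebra of a complete MVD-algebra. -/
def CMVD.toCLCA (A : CMVD.{u}) : CLCA.{u} :=
  ⟨A.carrier, llContact A.ll, {a | A.ll a ⊤}, A.isMVD.isLocalContact⟩

/-- An isomorphism of categories needs equality of objects. The round trips keep the carrier
definitionally, so only the relations have to be compared. -/
theorem CLCA.mk_congr {B : Type u} [CompleteBooleanAlgebra B] {ρ ρ' : B → B → Prop}
    {bdd bdd' : Set B} (h : IsLocalContact ρ bdd) (h' : IsLocalContact ρ' bdd') (hρ : ρ = ρ')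
    (hb : bdd = bdd') : CLCA.mk B ρ bdd h = CLCA.mk B ρ' bdd' h' := by
  subst hρ hb
  rfl

theorem CMVD.mk_congr {B : Type u} [CompleteBooleanAlgebra B] {ll ll' : B → B → Prop}
    (h : IsMVD ll) (h' : IsMVD ll') (hl : ll = ll') : CMVD.mk B ll h = CMVD.mk B ll' h' := by
  subst hl
  rfl

theorem CLCA.toCLCA_toCMVD (A : CLCA.{u}) : A.toCMVD.toCLCA = A :=
  CLCA.mk_congr _ A.isLocalContact A.isLocalContact.llContact_bddLL
    (Set.ext fun _ => A.isLocalContact.bddLL_top)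

theorem CMVD.toCMVD_toCLCA (A : CMVD.{u}) : A.toCLCA.toCMVD = A :=
  CMVD.mk_congr _ A.isMVD A.isMVD.bddLL_llContact

theorem le_map_lowerAdj {A B : Type u} [CompleteBooleanAlgebra A] [CompleteBooleanAlgebra B]
    (φ : CompleteLatticeHom A B) (b : B) : b ≤ φ (lowerAdj φ b) :=
  (gc_lowerAdj φ).le_u_l b

theorem map_mono {A B : Type u} [CompleteBooleanAlgebra A] [CompleteBooleanAlgebra B]
    (φ : CompleteLatticeHom A B) : Monotone φ :=
  OrderHomClass.mono φ

/-- Frobenius reciprocity for the lower adjoint. -/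
theorem inf_lowerAdj_le {A B : Type u} [CompleteBooleanAlgebra A] [CompleteBooleanAlgebra B]
    (φ : CompleteLatticeHom A B) (a : A) (b : B) :
    a ⊓ lowerAdj φ b ≤ lowerAdj φ (φ a ⊓ b) := by
  -- With `a` moved across as `aᶜ`, the adjunction reduces the claim to `b ≤ (φ a)ᶜ ⊔ (φ a ⊓ b)`.
  have h : lowerAdj φ b ≤ aᶜ ⊔ lowerAdj φ (φ a ⊓ b) := by
    rw [gc_lowerAdj φ, map_sup, map_compl']
    refine le_trans ?_ (sup_le_sup_left (le_map_lowerAdj φ _) _)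
    rw [sup_inf_left, sup_comm, sup_compl_eq_top, top_inf_eq]
    exact le_sup_right
  refine (inf_le_inf_left a h).trans ?_
  rw [inf_sup_left, inf_compl_self, bot_sup_eq]
  exact inf_le_right

theorem IsSAL.isIA {A B : CLCA.{u}} {φ : CompleteLatticeHom A.carrier B.carrier} (h : IsSAL φ) :
    IsIA (A := A.toCMVD) (B := B.toCMVD) φ where
  es1 (a b : A.carrier) hab := ⟨h.l3 _ hab.1, fun hc => hab.2 (h.l1 _ _ (by rwa [map_compl']))⟩
  s2 b hb := A.isLocalContact.bddLL_top.2 (h.l2 _ hb.1)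
  s3 a ha := B.isLocalContact.bddLL_top.2 (h.l3 _ ha.1)

/-- For (L1), bounded witnesses of contact are pushed down by the lower adjoint. They stay bounded
by (S2), and if they were separated downstairs, (ES1) would separate the original witnesses. -/
theorem IsIA.isSAL {A B : CMVD.{u}} {φ : CompleteLatticeHom A.carrier B.carrier} (h : IsIA φ) :
    IsSAL (A := A.toCLCA) (B := B.toCLCA) φ where
  l1 := by
    rintro a b ⟨c, hc, d, hd, hc1, hd1, hcd⟩
    refine ⟨lowerAdj φ c, (gc_lowerAdj φ _ _).2 hc, lowerAdj φ d, (gc_lowerAdj φ _ _).2 hd,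
      h.s2 _ hc1, h.s2 _ hd1, fun hn => hcd ?_⟩
    have := h.es1 _ _ hn
    rw [map_compl'] at this
    exact B.isMVD.mono _ _ _ _ (le_map_lowerAdj φ c) this
      (compl_le_compl (le_map_lowerAdj φ d))
  l2 := h.s2
  l3 := h.s3

/-- (LS) concerns bounded elements only, while `bᶜ` need not be bounded. The contact is therefore
cut down to a bounded `c` below; Frobenius reciprocity moves `c` inside the adjoint, and `φ c ⊓ bᶜ`
is bounded by (L3). -/
theorem CondLS.condCS {A B : CLCA.{u}} {φ : CompleteLatticeHom A.carrier B.carrier}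
    (h : CondLS φ) (hφ : IsSAL φ) : CondCS (A := A.toCMVD) (B := B.toCMVD) φ := by
  intro (a : B.carrier) (b : B.carrier) hab
  refine ⟨hφ.l2 _ hab.1, fun (hc : A.ρ (lowerAdj φ a) (lowerAdj φ bᶜ)ᶜᶜ) => ?_⟩
  rw [compl_compl] at hc
  obtain ⟨c, hc1, hc2⟩ := A.isLocalContact.contact_bdd _ _ hc
  refine hab.2 (B.isLocalContact.mono_right (h a hab.1 (φ c ⊓ bᶜ)
    (B.isLocalContact.mem_of_le _ _ inf_le_left (hφ.l3 c hc1)) ?_) inf_le_right)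
  exact A.isLocalContact.mono_right hc2 (inf_lowerAdj_le φ c bᶜ)

theorem CondCS.condLS {A B : CMVD.{u}} {φ : CompleteLatticeHom A.carrier B.carrier}
    (h : CondCS φ) (hφ : IsIA φ) : CondLS (A := A.toCLCA) (B := B.toCLCA) φ := by
  intro (a : B.carrier) ha (b : B.carrier) hb hab
  refine ⟨a, le_rfl, b, le_rfl, ha, hb, fun hn => ?_⟩
  have h1 := h _ _ hn
  rw [compl_compl] at h1
  refine (A.isMVD.not_llContact (hφ.s2 a ha)).2 h1 ?_
  rw [compl_compl]
  exact hab

/-- The functor from injective SAL-morphisms to injective IA-morphisms. -/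
def ISAL.toIIA : ISAL.{u} ⥤ IIA.{u} where
  obj A := ⟨A.toCLCA.toCMVD⟩
  map f := ⟨ISAL.Hom.map f, ISAL.Hom.injective f, (ISAL.Hom.isSAL f).isIA⟩

/-- The functor from injective IA-morphisms to injective SAL-morphisms. -/
def IIA.toISAL : IIA.{u} ⥤ ISAL.{u} where
  obj A := ⟨A.toCMVD.toCLCA⟩
  map f := ⟨IIA.Hom.map f, IIA.Hom.injective f, (IIA.Hom.isIA f).isSAL⟩

/-- The functor from SAL-morphisms with (LS) to IA-morphisms with (CS). -/
def SSAL.toSIA : SSAL.{u} ⥤ SIA.{u} where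
  obj A := ⟨A.toCLCA.toCMVD⟩
  map f := ⟨SSAL.Hom.map f, (SSAL.Hom.isSAL f).isIA, (SSAL.Hom.condLS f).condCS (SSAL.Hom.isSAL f)⟩

/-- The functor from IA-morphisms with (CS) to SAL-morphisms with (LS). -/
def SIA.toSSAL : SIA.{u} ⥤ SSAL.{u} where
  obj A := ⟨A.toCMVD.toCLCA⟩
  map f := ⟨SIA.Hom.map f, (SIA.Hom.isIA f).isSAL, (SIA.Hom.condCS f).condLS (SIA.Hom.isIA f)⟩

/-- The endpoints of a round-tripped morphism agree only propositionally, hence the heterogeneous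
equality; the underlying maps are literally the same. -/
theorem ISAL.Hom.hext {A A' B B' : ISAL.{u}} (hA : A = A') (hB : B = B') {f : ISAL.Hom A B}
    {g : ISAL.Hom A' B'} (h : HEq f.map g.map) : HEq f g := by
  subst hA hB
  exact heq_of_eq (ISAL.Hom.ext (eq_of_heq h))

theorem IIA.Hom.hext {A A' B B' : IIA.{u}} (hA : A = A') (hB : B = B') {f : IIA.Hom A B}
    {g : IIA.Hom A' B'} (h : HEq f.map g.map) : HEq f g := by
  subst hA hB
  exact heq_of_eq (IIA.Hom.ext (eq_of_heq h))

theorem SSAL.Hom.hext {A A' B B' : SSAL.{u}} (hA : A = A') (hB : B = B') {f : SSAL.Hom A B}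
    {g : SSAL.Hom A' B'} (h : HEq f.map g.map) : HEq f g := by
  subst hA hB
  exact heq_of_eq (SSAL.Hom.ext (eq_of_heq h))

theorem SIA.Hom.hext {A A' B B' : SIA.{u}} (hA : A = A') (hB : B = B') {f : SIA.Hom A B}
    {g : SIA.Hom A' B'} (h : HEq f.map g.map) : HEq f g := by
  subst hA hB
  exact heq_of_eq (SIA.Hom.ext (eq_of_heq h))

theorem isomorphic_ISAL_IIA : IsomorphicCategories ISAL.{u} IIA.{u} := by
  have h1 : ∀ A : ISAL.{u}, (ISAL.toIIA ⋙ IIA.toISAL).obj A = A :=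
    fun A => congrArg ISAL.mk A.toCLCA.toCLCA_toCMVD
  have h2 : ∀ A : IIA.{u}, (IIA.toISAL ⋙ ISAL.toIIA).obj A = A :=
    fun A => congrArg IIA.mk A.toCMVD.toCMVD_toCLCA
  exact ⟨ISAL.toIIA, IIA.toISAL,
    Functor.hext h1 fun A B f => ISAL.Hom.hext (h1 A) (h1 B) HEq.rfl,
    Functor.hext h2 fun A B f => IIA.Hom.hext (h2 A) (h2 B) HEq.rfl⟩

theorem isomorphic_SSAL_SIA : IsomorphicCategories SSAL.{u} SIA.{u} := by
  have h1 : ∀ A : SSAL.{u}, (SSAL.toSIA ⋙ SIA.toSSAL).obj A = A :=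
    fun A => congrArg SSAL.mk A.toCLCA.toCLCA_toCMVD
  have h2 : ∀ A : SIA.{u}, (SIA.toSSAL ⋙ SSAL.toSIA).obj A = A :=
    fun A => congrArg SIA.mk A.toCMVD.toCMVD_toCLCA
  exact ⟨SSAL.toSIA, SIA.toSSAL,
    Functor.hext h1 fun A B f => SSAL.Hom.hext (h1 A) (h1 B) HEq.rfl,
    Functor.hext h2 fun A B f => SIA.Hom.hext (h2 A) (h2 B) HEq.rfl⟩

end RegionBased

/-! ### The complete Boolean algebra of regular elements of a frame -/

namespace Heyting.Regular

variable {α β : Type*} [Order.Frame α] [Order.Frame β]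

instance : SupSet (Regular α) := ⟨fun S => toRegular (sSup ((↑) '' S))⟩

instance : InfSet (Regular α) := ⟨fun S => (sSup (compl '' S))ᶜ⟩

theorem coe_sSup (S : Set (Regular α)) :
    ((sSup S : Regular α) : α) = (sSup ((↑) '' S : Set α))ᶜᶜ := rfl

theorem isLUB_sSup' (S : Set (Regular α)) : IsLUB S (sSup S) := by
  constructor
  · intro a ha
    exact coe_le_coe.1 ((le_sSup (Set.mem_image_of_mem _ ha)).trans le_compl_compl)
  · intro b hb
    refine gi.gc.l_le (sSup_le ?_)
    rintro _ ⟨a, ha, rfl⟩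
    exact coe_le_coe.2 (hb ha)

theorem isGLB_sInf' (S : Set (Regular α)) : IsGLB S (sInf S) := by
  constructor
  · intro a ha
    exact compl_le_of_compl_le ((isLUB_sSup' (compl '' S)).1 (Set.mem_image_of_mem _ ha))
  · intro b hb
    refine le_compl_comm.1 ((isLUB_sSup' (compl '' S)).2 ?_)
    rintro _ ⟨a, ha, rfl⟩
    exact compl_le_compl (hb ha)

instance : CompleteBooleanAlgebra (Regular α) where
  __ := (inferInstance : BooleanAlgebra (Regular α))
  isLUB_sSup := isLUB_sSup'
  isGLB_sInf := isGLB_sInf'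

end Heyting.Regular

/-! ### Complete homomorphisms between algebras of regular elements -/

namespace RegionBased

/-- A map between complete Boolean algebras preserving suprema and complements. -/
def homOfCompl {A B : Type*} [CompleteBooleanAlgebra A] [CompleteBooleanAlgebra B] (φ : A → B)
    (hs : ∀ S : Set A, φ (sSup S) = sSup (φ '' S)) (hc : ∀ a, φ aᶜ = (φ a)ᶜ) :
    CompleteLatticeHom A B where
  toFun := φ
  map_sSup' := hs
  map_sInf' S := by
    rw [← compl_compl (sInf S), hc, compl_sInf, iSup_subtype', iSup, hs, ← Set.range_comp,
      compl_sSup', ← Set.range_comp, Set.image_eq_range]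
    congr 2
    ext a
    simp [hc]

open Heyting in
/-- A frame homomorphism compatible with double negation acts on regular elements. -/
def regularMap {α β : Type*} [Order.Frame α] [Order.Frame β] (g : FrameHom α β)
    (hg : ∀ a, g aᶜᶜ ≤ (g a)ᶜᶜ) : CompleteLatticeHom (Regular α) (Regular β) :=
  -- Triple negation collapses, so the hypothesis allows an inner double negation to be dropped
  -- under an outer one.
  have key : ∀ a, (g aᶜᶜ)ᶜᶜ = (g a)ᶜᶜ := fun a =>
    le_antisymm (by simpa using compl_le_compl (compl_le_compl (hg a)))
      (compl_le_compl (compl_le_compl (OrderHomClass.mono g le_compl_compl)))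
  homOfCompl (fun a => Regular.toRegular (g a))
    (fun S => Regular.coe_injective (by
      rw [Regular.coe_toRegular, Regular.coe_sSup, key, map_sSup, Regular.coe_sSup]
      apply le_antisymm
      · refine compl_le_compl (compl_le_compl (sSup_le ?_))
        rintro _ ⟨_, ⟨a, ha, rfl⟩, rfl⟩
        exact le_compl_compl.trans (le_sSup ⟨_, ⟨a, ha, rfl⟩, rfl⟩)
      · rw [← compl_compl_compl (sSup (g '' _))ᶜ]
        refine compl_le_compl (compl_le_compl (sSup_le ?_))
        rintro _ ⟨_, ⟨a, ha, rfl⟩, rfl⟩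
        exact compl_le_compl (compl_le_compl (le_sSup ⟨_, ⟨a, ha, rfl⟩, rfl⟩))))
    (fun a => by
      symm
      refine IsCompl.compl_eq ⟨?_, ?_⟩
      · rw [disjoint_iff]
        apply Regular.coe_injective
        change (g (a : α))ᶜᶜ ⊓ (g ((aᶜ : Heyting.Regular α) : α))ᶜᶜ = _
        rw [← compl_compl_inf_distrib, ← map_inf, Regular.coe_compl, inf_compl_self, map_bot,
          Regular.coe_bot, compl_bot, compl_top]
      · rw [codisjoint_iff]
        apply Regular.coe_injective
        -- The element `a ⊔ aᶜ` is dense, and by `key` its image under `g` is dense too.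
        have h : (g (a ⊔ (a : α)ᶜ))ᶜᶜ = ⊤ := by
          rw [← key, compl_sup, inf_compl_self, compl_bot, map_top, compl_top, compl_bot]
        rw [Regular.coe_sup, Regular.coe_toRegular, Regular.coe_toRegular, Regular.coe_top,
          eq_top_iff, ← h, map_sup]
        exact compl_le_compl (compl_le_compl (sup_le_sup le_compl_compl le_compl_compl)))

/-! ### Regular open sets of a topological space -/

open TopologicalSpace

/-- The complete Boolean algebra of regular open sets. -/
abbrev RO (X : Type u) [TopologicalSpace X] : Type u := Heyting.Regular (Opens X)

namespace RO

variable {X : Type u} [TopologicalSpace X]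

instance : SetLike (RO X) X where
  coe U := ((U : Opens X) : Set X)
  coe_injective := SetLike.coe_injective.comp Heyting.Regular.coe_injective

theorem isOpen (U : RO X) : IsOpen (U : Set X) := (U : Opens X).isOpen

theorem le_iff {U V : RO X} : U ≤ V ↔ (U : Set X) ⊆ V := Iff.rfl

theorem coe_opens_compl (U : Opens X) : ((Uᶜ : Opens X) : Set X) = (closure (U : Set X))ᶜ := by
  rw [Opens.coe_compl_eq_interior_compl, interior_compl]

theorem coe_opens_compl_compl (U : Opens X) :
    ((Uᶜᶜ : Opens X) : Set X) = interior (closure (U : Set X)) := by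
  rw [coe_opens_compl, coe_opens_compl, closure_compl, compl_compl]

theorem coe_compl (U : RO X) : ((Uᶜ : RO X) : Set X) = (closure (U : Set X))ᶜ :=
  coe_opens_compl _

theorem coe_bot : ((⊥ : RO X) : Set X) = ∅ := rfl

theorem coe_top : ((⊤ : RO X) : Set X) = Set.univ := rfl

theorem interior_closure (U : RO X) : interior (closure (U : Set X)) = U := by
  refine (coe_opens_compl_compl (U : Opens X)).symm.trans ?_
  rw [U.prop.eq]
  rfl

theorem coe_sSup (S : Set (RO X)) :
    ((sSup S : RO X) : Set X) = interior (closure (⋃ U ∈ S, (U : Set X))) := by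
  change ((((sSup S : RO X) : Opens X)) : Set X) = _
  rw [Heyting.Regular.coe_sSup, coe_opens_compl_compl, Opens.coe_sSup, Set.biUnion_image]
  rfl

theorem le_iff_subset_closure {U V : RO X} : U ≤ V ↔ (U : Set X) ⊆ closure V := by
  rw [le_iff]
  refine ⟨fun h => h.trans subset_closure, fun h => ?_⟩
  rw [← V.interior_closure]
  exact interior_maximal h U.isOpen

/-- The regularization of a set. -/
def mk (W : Set X) : RO X := Heyting.Regular.toRegular (Opens.interior (closure W))

theorem coe_mk (W : Set X) : (mk W : Set X) = interior (closure W) := by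
  change ((Heyting.Regular.toRegular (Opens.interior (closure W)) : Opens X) : Set X) = _
  rw [Heyting.Regular.coe_toRegular, coe_opens_compl_compl, Opens.coe_interior,
    interior_closure_idem]

theorem subset_mk {W : Set X} (hW : IsOpen W) : W ⊆ mk W := by
  rw [coe_mk]
  exact interior_maximal subset_closure hW

theorem mk_subset (W : Set X) : (mk W : Set X) ⊆ closure W := by
  rw [coe_mk]
  exact interior_subset

theorem ne_bot_iff {U : RO X} : U ≠ ⊥ ↔ (U : Set X).Nonempty := by
  rw [Set.nonempty_iff_ne_empty, ← coe_bot, ne_eq, ne_eq, SetLike.coe_set_eq]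

/-- Regular open sets with closure inside a given neighbourhood. -/
theorem exists_closure_subset [RegularSpace X] {x : X} {s : Set X} (hs : s ∈ nhds x) :
    ∃ U : RO X, x ∈ U ∧ closure (U : Set X) ⊆ s := by
  obtain ⟨t, ht, htc, hts⟩ := exists_mem_nhds_isClosed_subset hs
  refine ⟨mk (interior t), subset_mk isOpen_interior (mem_interior_iff_mem_nhds.2 ht), ?_⟩
  refine (closure_minimal (mk_subset _) isClosed_closure).trans ?_
  exact (closure_minimal interior_subset htc).trans hts

/-- Regular open sets with compact closure inside a given neighbourhood. -/
theorem exists_isCompact_closure_subset [RegularSpace X] [LocallyCompactSpace X] {x : X}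
    {s : Set X} (hs : s ∈ nhds x) :
    ∃ U : RO X, x ∈ U ∧ IsCompact (closure (U : Set X)) ∧ closure (U : Set X) ⊆ s := by
  obtain ⟨K, hK, hKs, hKc⟩ := local_compact_nhds hs
  obtain ⟨U, hU, hUK⟩ := exists_closure_subset hK
  exact ⟨U, hU, hKc.of_isClosed_subset isClosed_closure hUK, hUK.trans hKs⟩

end RO

end RegionBased

namespace RegionBased

open TopologicalSpace

/-! ### The MVD-algebra of regular open sets -/

section

variable {X : Type u} [TopologicalSpace X]

/-- `U` is relatively compact with closure inside `V`. -/
def roLL (U V : RO X) : Prop :=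
  IsCompact (closure (U : Set X)) ∧ closure (U : Set X) ⊆ V

theorem RO.mem_compl_iff {U : RO X} {x : X} : x ∈ Uᶜ ↔ x ∉ closure (U : Set X) := by
  rw [← SetLike.mem_coe, RO.coe_compl, Set.mem_compl_iff]

/-- A point outside both closures lies in `Uᶜ ⊓ Vᶜ = (U ⊔ V)ᶜ`. -/
theorem RO.closure_sup_subset (U V : RO X) :
    closure ((U ⊔ V : RO X) : Set X) ⊆ closure (U : Set X) ∪ closure V := by
  intro x hx
  by_contra hn
  rw [Set.mem_union, not_or, ← mem_compl_iff, ← mem_compl_iff] at hn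
  have h : x ∈ (U ⊔ V)ᶜ := by
    rw [compl_sup]
    exact hn
  exact mem_compl_iff.1 h hx

theorem RO.disjoint_closure_compl (V : RO X) :
    Disjoint (V : Set X) (closure ((Vᶜ : RO X) : Set X)) := by
  refine Disjoint.closure_right ?_ V.isOpen
  rw [coe_compl]
  exact Set.disjoint_compl_right_iff_subset.2 subset_closure

theorem RO.mem_of_notMem_closure_compl {V : RO X} {x : X}
    (hx : x ∉ closure ((Vᶜ : RO X) : Set X)) : x ∈ V := by
  rwa [← mem_compl_iff, compl_compl] at hx

theorem roLL_top {U : RO X} : roLL U ⊤ ↔ IsCompact (closure (U : Set X)) :=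
  ⟨And.left, fun h => ⟨h, Set.subset_univ _⟩⟩

variable [LocallyCompactSpace X] [T2Space X]

theorem exists_between_isCompact_RO {K : Set X} (hK : IsCompact K) {O : Set X} (hO : IsOpen O)
    (h : K ⊆ O) :
    ∃ W : RO X, K ⊆ W ∧ IsCompact (closure (W : Set X)) ∧ closure (W : Set X) ⊆ O := by
  obtain ⟨L, hL, hKL, hLO⟩ := exists_compact_between hK hO h
  have h1 : closure (RO.mk (interior L) : Set X) ⊆ L :=
    (closure_minimal (RO.mk_subset _) isClosed_closure).trans
      (closure_minimal interior_subset hL.isClosed)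
  exact ⟨RO.mk (interior L), hKL.trans (RO.subset_mk isOpen_interior),
    hL.of_isClosed_subset isClosed_closure h1, h1.trans hLO⟩

/-- Local compactness enters through `interpolate` and `exists_ll`. -/
theorem isMVD_roLL : IsMVD (roLL (X := X)) where
  le_of_ll U V h := RO.le_iff.2 (subset_closure.trans h.2)
  bot_ll := by
    rw [roLL, RO.coe_bot, closure_empty]
    exact ⟨isCompact_empty, le_rfl⟩
  mono a b c t hab hbc hct :=
    ⟨hbc.1.of_isClosed_subset isClosed_closure (closure_mono hab),
      (closure_mono hab).trans (hbc.2.trans hct)⟩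
  sup_ll a b c hac hbc :=
    ⟨(hac.1.union hbc.1).of_isClosed_subset isClosed_closure (RO.closure_sup_subset a b),
      (RO.closure_sup_subset a b).trans (Set.union_subset hac.2 hbc.2)⟩
  ll_inf a b c hab hac := ⟨hab.1, Set.subset_inter hab.2 hac.2⟩
  interpolate a c hac := by
    obtain ⟨W, h1, h2, h3⟩ := exists_between_isCompact_RO hac.1 c.isOpen hac.2
    exact ⟨W, ⟨hac.1, h1⟩, h2, h3⟩
  exists_ll a ha := by
    obtain ⟨x, hx⟩ := RO.ne_bot_iff.1 ha
    obtain ⟨U, hxU, hU⟩ := RO.exists_isCompact_closure_subset (a.isOpen.mem_nhds hx)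
    exact ⟨U, RO.ne_bot_iff.2 ⟨x, hxU⟩, hU⟩
  ll_of_compl a b ha hab := ⟨ha.1, fun x hx => RO.mem_of_notMem_closure_compl fun hxb =>
    RO.mem_compl_iff.1 (hab.2 hxb) hx⟩

/-- The complete MVD-algebra of regular open sets of a locally compact Hausdorff space. -/
def LCHaus.toCMVD (X : LCHaus.{u}) : CMVD.{u} :=
  ⟨RO X.carrier, roLL, isMVD_roLL⟩

end

/-! ### The homomorphism induced by a skeletal map -/

section

variable {X Y Z : Type u} [TopologicalSpace X] [TopologicalSpace Y] [TopologicalSpace Z]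

/-- This is the compatibility with double negation required by `regularMap`. Near a point of the
left side, skeletality gives a small open set whose image is dense in some non-empty open set; the
image lies in `closure W`, so that open set meets `W`, and hence so does the image. -/
theorem IsSkeletal.preimage_subset {f : X → Y} (hs : IsSkeletal f) (hc : Continuous f)
    {W : Set Y} (hW : IsOpen W) : f ⁻¹' interior (closure W) ⊆ interior (closure (f ⁻¹' W)) := by
  refine interior_maximal ?_ (isOpen_interior.preimage hc)
  intro x hx
  rw [mem_closure_iff]
  intro N hN hxN
  obtain ⟨y, hy⟩ := hs (N ∩ f ⁻¹' interior (closure W))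
    (hN.inter (isOpen_interior.preimage hc)) ⟨x, hxN, hx⟩
  have h1 : closure (f '' (N ∩ f ⁻¹' interior (closure W))) ⊆ closure W := by
    refine closure_minimal ?_ isClosed_closure
    rintro _ ⟨z, hz, rfl⟩
    exact interior_subset hz.2
  obtain ⟨z, hz1, hz2⟩ := mem_closure_iff.1 (h1 (interior_subset hy)) _ isOpen_interior hy
  obtain ⟨_, hw, v, hv, rfl⟩ := mem_closure_iff.1 (interior_subset hz1) _ hW hz2
  exact ⟨v, hv.1, hw⟩

/-- The complete Boolean homomorphism `U ↦ int (cl (f⁻¹ U))` induced by a skeletal map. -/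
def pullback {f : X → Y} (hs : IsSkeletal f) (hc : Continuous f) :
    CompleteLatticeHom (RO Y) (RO X) :=
  regularMap (Opens.comap ⟨f, hc⟩) fun U => by
    rw [← SetLike.coe_subset_coe, RO.coe_opens_compl_compl, Opens.coe_comap, Opens.coe_comap,
      RO.coe_opens_compl_compl]
    exact hs.preimage_subset hc U.isOpen

theorem coe_pullback {f : X → Y} (hs : IsSkeletal f) (hc : Continuous f) (U : RO Y) :
    (pullback hs hc U : Set X) = interior (closure (f ⁻¹' U)) :=
  RO.coe_opens_compl_compl (Opens.comap ⟨f, hc⟩ (U : Opens Y))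

theorem preimage_subset_pullback {f : X → Y} (hs : IsSkeletal f) (hc : Continuous f) (U : RO Y) :
    f ⁻¹' U ⊆ pullback hs hc U := by
  rw [coe_pullback]
  exact interior_maximal subset_closure (U.isOpen.preimage hc)

theorem closure_pullback_subset {f : X → Y} (hs : IsSkeletal f) (hc : Continuous f) (U : RO Y) :
    closure (pullback hs hc U : Set X) ⊆ f ⁻¹' closure (U : Set Y) := by
  rw [coe_pullback]
  refine closure_minimal (interior_subset.trans ?_) (isClosed_closure.preimage hc)
  exact closure_minimal (Set.preimage_mono subset_closure) (isClosed_closure.preimage hc)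

theorem pullback_id (hs : IsSkeletal (id : X → X)) (hc : Continuous (id : X → X)) :
    pullback hs hc = CompleteLatticeHom.id (RO X) := by
  ext U : 1
  apply SetLike.coe_injective
  rw [coe_pullback, Set.preimage_id, RO.interior_closure]
  rfl

theorem pullback_comp {f : X → Y} {g : Y → Z} (hf : IsSkeletal f) (hfc : Continuous f)
    (hg : IsSkeletal g) (hgc : Continuous g) (h : IsSkeletal (g ∘ f)) (hc : Continuous (g ∘ f)) :
    pullback h hc = (pullback hf hfc).comp (pullback hg hgc) := by
  ext U : 1
  apply SetLike.coe_injective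
  change _ = (pullback hf hfc (pullback hg hgc U) : Set X)
  rw [coe_pullback, coe_pullback, coe_pullback]
  apply subset_antisymm
  · refine interior_mono (closure_mono ?_)
    rw [Set.preimage_comp]
    exact Set.preimage_mono (interior_maximal subset_closure (U.isOpen.preimage hgc))
  · refine interior_maximal ?_ isOpen_interior
    refine interior_subset.trans (closure_minimal ?_ isClosed_closure)
    -- Skeletality of `f` absorbs the inner regularization.
    exact (hf.preimage_subset hfc (U.isOpen.preimage hgc)).trans interior_subset

theorem map_injective_of_ne_bot {A B : Type u} [CompleteBooleanAlgebra A]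
    [CompleteBooleanAlgebra B] (φ : CompleteLatticeHom A B) (h : ∀ a, a ≠ ⊥ → φ a ≠ ⊥) :
    Function.Injective φ := by
  have key : ∀ a b, φ a ≤ φ b → a ≤ b := by
    intro a b hab
    by_contra hn
    refine h (a \ b) (fun h0 => hn (sdiff_eq_bot_iff.1 h0)) ?_
    rw [map_sdiff', sdiff_eq_bot_iff.2 hab]
  exact fun a b hab => (key _ _ hab.le).antisymm (key _ _ hab.ge)

theorem pullback_injective {f : X → Y} (hs : IsSkeletal f) (hc : Continuous f)
    (hf : Function.Surjective f) : Function.Injective (pullback hs hc) := by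
  refine map_injective_of_ne_bot _ fun U hU => ?_
  obtain ⟨y, hy⟩ := RO.ne_bot_iff.1 hU
  obtain ⟨x, rfl⟩ := hf y
  exact RO.ne_bot_iff.2 ⟨x, preimage_subset_pullback hs hc U hy⟩

/-- The range is closed, so a missed point has a regular open neighbourhood `V` whose closure avoids
the range. The pullback of `V` is then empty although `V` is not. -/
theorem surjective_of_pullback_injective [RegularSpace Y] {f : X → Y} (hs : IsSkeletal f)
    (hc : Continuous f) (hcl : IsClosedMap f) (hi : Function.Injective (pullback hs hc)) :
    Function.Surjective f := by
  rw [← Set.range_eq_univ]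
  by_contra hne
  obtain ⟨y, hy⟩ := (Set.ne_univ_iff_exists_notMem _).1 hne
  obtain ⟨V, hyV, hV⟩ := RO.exists_closure_subset (hcl.isClosed_range.isOpen_compl.mem_nhds hy)
  have h0 : V ≠ ⊥ := RO.ne_bot_iff.2 ⟨y, hyV⟩
  refine h0 (hi ?_)
  rw [map_bot]
  by_contra hn
  obtain ⟨x, hx⟩ := RO.ne_bot_iff.1 hn
  exact hV (closure_pullback_subset hs hc V (subset_closure hx)) (Set.mem_range_self x)

variable [LocallyCompactSpace Y] [T2Space Y]

/-- Membership of `x` in the pullback of `V` only puts `f x` in `closure V`; shrinking to `W ≪ V`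
repairs this. The formula recovers `f` from its pullback, and serves in `IsIA.exists_map` as the
definition of the map. -/
theorem mem_iff_exists_mem_pullback {f : X → Y} (hs : IsSkeletal f) (hc : Continuous f) {x : X}
    {V : RO Y} : f x ∈ V ↔ ∃ W, roLL W V ∧ x ∈ pullback hs hc W := by
  constructor
  · intro hx
    obtain ⟨W, hxW, hW⟩ := RO.exists_isCompact_closure_subset (V.isOpen.mem_nhds hx)
    exact ⟨W, hW, preimage_subset_pullback hs hc W hxW⟩
  · rintro ⟨W, hWV, hx⟩
    exact hWV.2 (closure_pullback_subset hs hc W (subset_closure hx))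

theorem eq_of_forall_mem_RO [RegularSpace X] [T2Space X] {x y : X}
    (h : ∀ U : RO X, x ∈ U → y ∈ U) : x = y := by
  by_contra hne
  obtain ⟨U, hxU, hU⟩ := RO.exists_closure_subset (isOpen_compl_singleton.mem_nhds hne)
  exact hU (subset_closure (h U hxU)) rfl

theorem eq_of_pullback_eq {f g : X → Y} (hf : IsSkeletal f) (hfc : Continuous f)
    (hg : IsSkeletal g) (hgc : Continuous g) (h : pullback hf hfc = pullback hg hgc) : f = g := by
  funext x
  refine eq_of_forall_mem_RO fun U hU => ?_
  rw [mem_iff_exists_mem_pullback hf hfc, h] at hU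
  exact (mem_iff_exists_mem_pullback hg hgc).2 hU

end

/-! ### Skeletal perfect maps, IA-morphisms and (CS) -/

section

variable {X Y : LCHaus.{u}} {f : X.carrier → Y.carrier}

theorem IsSkelPerfect.isIA (h : IsSkelPerfect f) :
    IsIA (A := Y.toCMVD) (B := X.toCMVD) (pullback h.isSkeletal h.isPerfectMap.continuous) := by
  have hp : IsProperMap f := (isPerfectMap_iff_isProperMap f).1 h.isPerfectMap
  have es1 : ∀ U V : RO Y.carrier, roLL U V →
      roLL (pullback h.isSkeletal h.isPerfectMap.continuous U)
        (pullback h.isSkeletal h.isPerfectMap.continuous V) := by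
    intro U V hUV
    have h1 := closure_pullback_subset h.isSkeletal h.isPerfectMap.continuous U
    exact ⟨(hp.isCompact_preimage hUV.1).of_isClosed_subset isClosed_closure h1,
      h1.trans ((Set.preimage_mono hUV.2).trans (preimage_subset_pullback _ _ V))⟩
  refine ⟨es1, fun (U : RO X.carrier) hU => ?_, fun (U : RO Y.carrier) hU => ?_⟩
  -- For (S2): the image of `closure U` is compact, and any relatively compact `W` around it bounds
  -- the lower adjoint of `U`.
  · obtain ⟨W, hW1, hW2, -⟩ := exists_between_isCompact_RO (hU.1.image hp.continuous) isOpen_univ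
      (Set.subset_univ _)
    refine isMVD_roLL.mono _ W ⊤ _ ((gc_lowerAdj _ _ _).2 ?_) (roLL_top.2 hW2) le_rfl
    refine RO.le_iff.2 (Set.Subset.trans ?_ (preimage_subset_pullback _ _ W))
    exact subset_closure.trans (Set.image_subset_iff.1 hW1)
  · have := es1 U ⊤ hU
    rwa [map_top] at this

/-- The lower adjoint of the homomorphism induced by `f` lies in the closure of the image. -/
theorem closure_lowerAdj_pullback_subset {X Y : Type u} [TopologicalSpace X] [TopologicalSpace Y]
    {f : X → Y} (hs : IsSkeletal f) (hc : Continuous f) (U : RO X) :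
    closure ((lowerAdj (pullback hs hc) U : RO Y) : Set Y) ⊆ closure (f '' U) := by
  refine closure_minimal ?_ isClosed_closure
  refine Set.Subset.trans ?_ (RO.mk_subset (f '' U))
  -- By adjunction it is enough that `U` lies below the pullback of the regularization of `f '' U`;
  -- density of that pullback in `U` comes from skeletality.
  rw [← RO.le_iff, gc_lowerAdj, RO.le_iff_subset_closure]
  intro x hx
  rw [mem_closure_iff]
  intro N hN hxN
  obtain ⟨y, hy⟩ := hs (N ∩ U) (hN.inter U.isOpen) ⟨x, hxN, hx⟩
  obtain ⟨_, hz, v, hv, rfl⟩ := mem_closure_iff.1 (interior_subset hy) _ isOpen_interior hy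
  refine ⟨v, hv.1, preimage_subset_pullback hs hc _ ?_⟩
  rw [Set.mem_preimage, RO.coe_mk]
  exact interior_mono (closure_mono (Set.image_mono Set.inter_subset_right)) hz

theorem subset_closure_lowerAdj_pullback {X Y : Type u} [TopologicalSpace X] [TopologicalSpace Y]
    {f : X → Y} (hs : IsSkeletal f) (hc : Continuous f) {U : RO X} {x : X} (hx : x ∈ U) :
    f x ∈ closure ((lowerAdj (pullback hs hc) U : RO Y) : Set Y) :=
  closure_pullback_subset hs hc _ (subset_closure (le_map_lowerAdj (pullback hs hc) U hx))

/-- Since `f` is closed, the closure of the lower adjoint of `U` lies in the image of `closure U`.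
Injectivity keeps the images of the disjoint sets `closure U` and `closure Vᶜ` disjoint. -/
theorem IsSkelPerfect.condCS (h : IsSkelPerfect f) (hi : Function.Injective f) :
    CondCS (A := Y.toCMVD) (B := X.toCMVD)
      (pullback h.isSkeletal h.isPerfectMap.continuous) := by
  have hp : IsProperMap f := (isPerfectMap_iff_isProperMap f).1 h.isPerfectMap
  have key : ∀ U : RO X.carrier,
      closure ((lowerAdj (pullback h.isSkeletal hp.continuous) U : RO Y.carrier) : Set Y.carrier) ⊆
        f '' closure (U : Set X.carrier) := by
    intro U
    refine (closure_lowerAdj_pullback_subset h.isSkeletal hp.continuous U).trans ?_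
    exact closure_minimal (Set.image_mono subset_closure) (hp.isClosedMap _ isClosed_closure)
  intro (U : RO X.carrier) (V : RO X.carrier) hUV
  refine ⟨(hUV.1.image hp.continuous).of_isClosed_subset isClosed_closure (key U), ?_⟩
  intro y hy
  refine RO.mem_compl_iff.2 fun hy' => ?_
  obtain ⟨x, hx, rfl⟩ := key U hy
  obtain ⟨x', hx', hxx⟩ := key Vᶜ hy'
  rw [hi hxx] at hx'
  exact Set.disjoint_left.1 V.disjoint_closure_compl (hUV.2 hx) hx'

/-- If `f x = f y` with `x ≠ y`, take `U ≪ V` around `x` with `y` outside `closure V`. The common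
value lies in the closures of the lower adjoints of both `U` and `Vᶜ`, which (CS) separates. -/
theorem injective_of_condCS (hs : IsSkeletal f) (hc : Continuous f)
    (h : CondCS (A := Y.toCMVD) (B := X.toCMVD) (pullback hs hc)) : Function.Injective f := by
  intro x y hxy
  by_contra hne
  obtain ⟨V, hxV, hV⟩ := RO.exists_closure_subset (isOpen_compl_singleton.mem_nhds hne)
  obtain ⟨U, hxU, hU⟩ := RO.exists_isCompact_closure_subset (V.isOpen.mem_nhds hxV)
  have h1 := (h U V hU).2 (subset_closure_lowerAdj_pullback hs hc hxU)
  refine RO.mem_compl_iff.1 h1 ?_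
  rw [hxy]
  refine subset_closure_lowerAdj_pullback hs hc (RO.mem_compl_iff.2 fun hy => hV hy rfl)

end

end RegionBased

namespace RegionBased

open TopologicalSpace

/-! ### Ends of MVD-algebras -/

section

variable {B : Type u} [BooleanAlgebra B] {ll : B → B → Prop}

/-- Proper filters in which every element has an element of the filter well inside it. -/
structure IsRoundFilter (ll : B → B → Prop) (E : Set B) : Prop where
  top_mem : ⊤ ∈ E
  bot_notMem : ⊥ ∉ E
  mem_of_le : ∀ a b, a ≤ b → a ∈ E → b ∈ E
  inf_mem : ∀ a b, a ∈ E → b ∈ E → a ⊓ b ∈ E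
  exists_ll : ∀ a ∈ E, ∃ b ∈ E, ll b a

/-- The round filters which decide every pair `a ≪ b`; these are the maximal round filters. -/
structure IsEnd (ll : B → B → Prop) (E : Set B) : Prop extends IsRoundFilter ll E where
  compl_mem_or : ∀ a b, ll a b → aᶜ ∈ E ∨ b ∈ E

theorem IsRoundFilter.compl_notMem {E : Set B} (h : IsRoundFilter ll E) {a : B} (ha : a ∈ E) :
    aᶜ ∉ E := fun hc => h.bot_notMem (by
  rw [← inf_compl_self (a := a)]
  exact h.inf_mem _ _ ha hc)

/-- For `b ∈ F`, roundness gives `a ≪ b` with `a ∈ F`. The end `E` decides this pair and cannot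
contain `aᶜ`. -/
theorem IsEnd.eq_of_subset {E F : Set B} (hE : IsEnd ll E) (hF : IsRoundFilter ll F)
    (h : E ⊆ F) : E = F := by
  refine h.antisymm fun b hb => ?_
  obtain ⟨a, ha, hab⟩ := hF.exists_ll b hb
  exact (hE.compl_mem_or a b hab).resolve_left fun hc => hF.compl_notMem ha (h hc)

/-- If `aᶜ ∉ E`, adjoining to `E` all `c` with `a ≪ c` keeps it proper: `e ⊓ c = ⊥` would give `e ≤
cᶜ ≤ aᶜ`. Interpolation keeps it round, so maximality puts `b` in `E`. -/
theorem IsMVD.isEnd_of_maximal (h : IsMVD ll) {E : Set B} (hE : Maximal (IsRoundFilter ll) E) :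
    IsEnd ll E := by
  refine ⟨hE.1, fun a b hab => or_iff_not_imp_left.2 fun ha => ?_⟩
  have hF : IsRoundFilter ll {x | ∃ e ∈ E, ∃ c, ll a c ∧ e ⊓ c ≤ x} := by
    refine ⟨⟨⊤, hE.1.top_mem, b, hab, le_top⟩, ?_, ?_, ?_, ?_⟩
    · rintro ⟨e, he, c, hc, hec⟩
      refine ha (hE.1.mem_of_le _ _ ?_ he)
      rw [le_compl_iff_disjoint_right]
      exact (disjoint_iff_inf_le.2 hec).mono_right (h.le_of_ll _ _ hc)
    · rintro x y hxy ⟨e, he, c, hc, hec⟩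
      exact ⟨e, he, c, hc, hec.trans hxy⟩
    · rintro x y ⟨e, he, c, hc, hec⟩ ⟨e', he', c', hc', hec'⟩
      refine ⟨e ⊓ e', hE.1.inf_mem _ _ he he', c ⊓ c', h.ll_inf _ _ _ hc hc', ?_⟩
      rw [inf_inf_inf_comm]
      exact inf_le_inf hec hec'
    · rintro x ⟨e, he, c, hc, hec⟩
      obtain ⟨e', he', hee⟩ := hE.1.exists_ll e he
      obtain ⟨c', hac, hcc⟩ := h.interpolate _ _ hc
      exact ⟨e' ⊓ c', ⟨e', he', c', hac, le_rfl⟩,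
        h.mono _ _ _ _ le_rfl (h.inf_ll_inf hee hcc) hec⟩
  exact hE.2 hF (fun e he => ⟨e, he, b, hab, inf_le_left⟩)
    ⟨⊤, hE.1.top_mem, b, hab, inf_le_right⟩

/-- Zorn's lemma applied above the round filter `{x | c ≪ x}`, where `⊥ ≠ c ≪ b`. -/
theorem IsMVD.exists_isEnd (h : IsMVD ll) {b : B} (hb : b ≠ ⊥) : ∃ E, IsEnd ll E ∧ b ∈ E := by
  obtain ⟨c, hc, hcb⟩ := h.exists_ll b hb
  have hF : IsRoundFilter ll {x | ll c x} := by
    refine ⟨h.ll_top hcb, fun h0 => hc (le_bot_iff.1 (h.le_of_ll _ _ h0)),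
      fun x y hxy hx => h.mono _ _ _ _ le_rfl hx hxy, fun x y hx hy => h.ll_inf _ _ _ hx hy,
      fun x hx => h.interpolate _ _ hx⟩
  obtain ⟨E, hFE, hE⟩ := zorn_subset_nonempty {E | IsRoundFilter ll E} (by
    intro C hC hchain hne
    obtain ⟨D, hD⟩ := hne
    refine ⟨⋃₀ C, ⟨⟨D, hD, (hC hD).top_mem⟩, ?_, ?_, ?_, ?_⟩, fun s hs =>
      Set.subset_sUnion_of_mem hs⟩
    · rintro ⟨s, hs, h0⟩
      exact (hC hs).bot_notMem h0
    · rintro x y hxy ⟨s, hs, hx⟩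
      exact ⟨s, hs, (hC hs).mem_of_le _ _ hxy hx⟩
    · rintro x y ⟨s, hs, hx⟩ ⟨t, ht, hy⟩
      rcases hchain.total hs ht with hst | hst
      · exact ⟨t, ht, (hC ht).inf_mem _ _ (hst hx) hy⟩
      · exact ⟨s, hs, (hC hs).inf_mem _ _ hx (hst hy)⟩
    · rintro x ⟨s, hs, hx⟩
      obtain ⟨y, hy, hyx⟩ := (hC hs).exists_ll x hx
      exact ⟨y, ⟨s, hs, hy⟩, hyx⟩) _ hF
  exact ⟨E, h.isEnd_of_maximal hE, hFE hcb⟩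

end

/-- Ends are pulled back along IA-morphisms. -/
theorem IsIA.isEnd {A B : CMVD.{u}} {φ : CompleteLatticeHom A.carrier B.carrier} (h : IsIA φ)
    {E : Set B.carrier} (hE : IsEnd B.ll E) : IsEnd A.ll {a | ∃ c, A.ll c a ∧ φ c ∈ E} := by
  -- A bounded member of `E`; by (S2) its lower adjoint is a bounded element whose image is in `E`.
  obtain ⟨b₀, hb₀, hb₀'⟩ := hE.exists_ll ⊤ hE.top_mem
  have hbd : A.ll (lowerAdj φ b₀) ⊤ := h.s2 _ hb₀'
  have hmem : φ (lowerAdj φ b₀) ∈ E := hE.mem_of_le _ _ (le_map_lowerAdj φ b₀) hb₀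
  refine ⟨⟨⟨_, hbd, hmem⟩, ?_, ?_, ?_, ?_⟩, ?_⟩
  · rintro ⟨c, hc, hcE⟩
    rw [le_bot_iff.1 (A.isMVD.le_of_ll _ _ hc), map_bot] at hcE
    exact hE.bot_notMem hcE
  · rintro a b hab ⟨c, hc, hcE⟩
    exact ⟨c, A.isMVD.mono _ _ _ _ le_rfl hc hab, hcE⟩
  · rintro a b ⟨c, hc, hcE⟩ ⟨d, hd, hdE⟩
    refine ⟨c ⊓ d, A.isMVD.inf_ll_inf hc hd, ?_⟩
    rw [map_inf]
    exact hE.inf_mem _ _ hcE hdE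
  · rintro a ⟨c, hc, hcE⟩
    obtain ⟨b, hcb, hba⟩ := A.isMVD.interpolate _ _ hc
    exact ⟨b, ⟨c, hcb, hcE⟩, hba⟩
  · intro a b hab
    -- Two interpolants `a ≪ c ≪ d ≪ b` leave room on both sides of the pair that `E` decides. As
    -- `cᶜ` need not be bounded, it is met with the bounded element above.
    obtain ⟨d, had, hdb⟩ := A.isMVD.interpolate _ _ hab
    obtain ⟨c, hac, hcd⟩ := A.isMVD.interpolate _ _ had
    refine (hE.compl_mem_or _ _ (h.es1 _ _ hcd)).imp (fun hc => ?_) (fun hd => ⟨d, hdb, hd⟩)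
    refine ⟨cᶜ ⊓ lowerAdj φ b₀, A.isMVD.compl_inf_ll_compl hac hbd, ?_⟩
    rw [map_inf, map_compl']
    exact hE.inf_mem _ _ hc hmem

/-! ### Ends of the algebra of regular open sets are points -/

section

variable {X : Type u} [TopologicalSpace X] [LocallyCompactSpace X] [T2Space X]

theorem isEnd_nhds (x : X) : IsEnd (roLL (X := X)) {U | x ∈ U} where
  top_mem := Set.mem_univ x
  bot_notMem h := h
  mem_of_le U V h hx := h hx
  inf_mem U V hU hV := ⟨hU, hV⟩
  exists_ll U hU := RO.exists_isCompact_closure_subset (U.isOpen.mem_nhds hU)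
  compl_mem_or U V h := or_iff_not_imp_left.2 fun hx => h.2 (by
    by_contra hc
    exact hx (RO.mem_compl_iff.2 hc))

/-- The end has a relatively compact member `V`, so the closures of the sets `U ⊓ V` with `U ∈ E`
have a common point. Roundness puts this point in every member of `E`, and an end contained in the
neighbourhood end equals it. -/
theorem IsEnd.exists_point {E : Set (RO X)} (hE : IsEnd roLL E) : ∃ x, E = {U | x ∈ U} := by
  obtain ⟨V, hV, hVc⟩ := hE.exists_ll ⊤ hE.top_mem
  have hne : (⋂ U : E, closure ((U : RO X) ⊓ V : RO X) : Set X).Nonempty := by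
    have : Nonempty E := ⟨⟨V, hV⟩⟩
    refine IsCompact.nonempty_iInter_of_directed_nonempty_isCompact_isClosed _ ?_ ?_ ?_ ?_
    · intro U W
      refine ⟨⟨U ⊓ W, hE.inf_mem _ _ U.2 W.2⟩, ?_, ?_⟩
      · exact closure_mono (RO.le_iff.1 (inf_le_inf_right _ inf_le_left))
      · exact closure_mono (RO.le_iff.1 (inf_le_inf_right _ inf_le_right))
    · intro U
      refine (RO.ne_bot_iff.1 fun h0 => hE.bot_notMem ?_).closure
      rw [← h0]
      exact hE.inf_mem _ _ U.2 hV
    · intro U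
      exact hVc.1.of_isClosed_subset isClosed_closure
        (closure_mono (RO.le_iff.1 inf_le_right))
    · exact fun U => isClosed_closure
  obtain ⟨x, hx⟩ := hne
  refine ⟨x, hE.eq_of_subset (isEnd_nhds x).toIsRoundFilter fun U hU => ?_⟩
  obtain ⟨W, hW, hWU⟩ := hE.exists_ll U hU
  exact hWU.2 (closure_mono (RO.le_iff.1 inf_le_left) (Set.mem_iInter.1 hx ⟨W, hW⟩))

theorem sSup_roLL (V : RO X) : sSup {W | roLL W V} = V := by
  apply le_antisymm
  · exact sSup_le fun W hW => isMVD_roLL.le_of_ll _ _ hW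
  · intro x hx
    obtain ⟨W, hxW, hW⟩ := RO.exists_isCompact_closure_subset (V.isOpen.mem_nhds hx)
    exact le_sSup (show W ∈ {W | roLL W V} from hW) hxW

end

/-- Every IA-morphism between algebras of regular open sets comes from a skeletal perfect map. -/
theorem IsIA.exists_map {X Y : LCHaus.{u}}
    {φ : CompleteLatticeHom (RO Y.carrier) (RO X.carrier)}
    (h : IsIA (A := Y.toCMVD) (B := X.toCMVD) φ) :
    ∃ (f : X.carrier → Y.carrier) (hf : IsSkelPerfect f),
      pullback hf.isSkeletal hf.isPerfectMap.continuous = φ := by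
  -- The image of `x` is the point of the end pulled back from the neighbourhoods of `x`.
  have hex : ∀ x : X.carrier, ∃ y : Y.carrier, ∀ V : RO Y.carrier,
      y ∈ V ↔ ∃ W, roLL W V ∧ x ∈ φ W := by
    intro x
    obtain ⟨y, hy⟩ := IsEnd.exists_point (h.isEnd (isEnd_nhds x))
    exact ⟨y, fun V => (Set.ext_iff.1 hy V).symm⟩
  choose f hf using hex
  have hpre : ∀ V : RO Y.carrier,
      f ⁻¹' V = ⋃ W ∈ {W : RO Y.carrier | roLL W V}, (φ W : Set X.carrier) := by
    intro V
    ext x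
    simp only [Set.mem_preimage, SetLike.mem_coe, hf, Set.mem_iUnion, Set.mem_ofPred_eq,
      exists_prop]
  have hle : ∀ V : RO Y.carrier, f ⁻¹' V ⊆ φ V := by
    intro V
    rw [hpre]
    exact Set.iUnion₂_subset fun W hW =>
      RO.le_iff.1 (map_mono φ (isMVD_roLL.le_of_ll _ _ hW))
  have hcont : Continuous f := by
    rw [continuous_iff_continuousAt]
    intro x s hs
    obtain ⟨V, hxV, hV⟩ := RO.exists_closure_subset hs
    have ho : IsOpen (f ⁻¹' (V : Set Y.carrier)) := by
      rw [hpre]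
      exact isOpen_biUnion fun W _ => (φ W).isOpen
    exact Filter.mem_of_superset (ho.mem_nhds hxV) (Set.preimage_mono (subset_closure.trans hV))
  have hφ : ∀ V : RO Y.carrier, (φ V : Set X.carrier) = interior (closure (f ⁻¹' V)) := by
    intro V
    -- `V` is the join of all `W ≪ V`, `φ` preserves joins, and the union of these `φ W` is the
    -- preimage of `V`.
    conv_lhs => rw [← sSup_roLL V]
    rw [map_sSup, RO.coe_sSup, Set.biUnion_image, hpre]
  have hskel : IsSkeletal f := by
    intro U hU hne
    rw [Set.nonempty_iff_ne_empty]
    intro h0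
    -- If `closure (f '' U)` has empty interior, the regular open sets avoiding it join to `⊤`.
    -- Their images under `φ` then have dense union, so one meets `U`, which is impossible.
    have hd : (sSup {V : RO Y.carrier | (V : Set Y.carrier) ⊆ (closure (f '' U))ᶜ}) = ⊤ := by
      rw [eq_top_iff, RO.le_iff_subset_closure]
      intro y _
      rw [mem_closure_iff]
      intro N hN hyN
      have hnot : ¬ N ⊆ closure (f '' U) := fun hs => by
        have := interior_maximal hs hN hyN
        rwa [h0] at this
      obtain ⟨z, hzN, hz⟩ := Set.not_subset.1 hnot
      obtain ⟨V, hzV, hV⟩ := RO.exists_closure_subset (isClosed_closure.isOpen_compl.mem_nhds hz)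
      exact ⟨z, hzN, RO.le_iff.1 (le_sSup (a := V) (subset_closure.trans hV)) hzV⟩
    have h1 := congrArg (fun W => ((φ W : RO X.carrier) : Set X.carrier)) hd
    simp only [map_sSup, map_top, RO.coe_sSup, Set.biUnion_image, RO.coe_top] at h1
    obtain ⟨x, hx⟩ := hne
    have hx1 := interior_subset (h1.symm ▸ Set.mem_univ x)
    obtain ⟨z, hzU, hz⟩ := mem_closure_iff.1 hx1 U hU hx
    obtain ⟨V, hV, hzV⟩ := Set.mem_iUnion₂.1 hz
    rw [hφ] at hzV
    obtain ⟨w, hwU, hw⟩ := mem_closure_iff.1 (interior_subset hzV) U hU hzU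
    exact hV hw (subset_closure (Set.mem_image_of_mem f hwU))
  have hprop : IsProperMap f := by
    rw [isProperMap_iff_isCompact_preimage]
    refine ⟨hcont, fun K hK => ?_⟩
    obtain ⟨V, hKV, hV, -⟩ := exists_between_isCompact_RO hK isOpen_univ (Set.subset_univ _)
    have hc : roLL (φ V) ⊤ := h.s3 V (roLL_top.2 hV)
    refine hc.1.of_isClosed_subset (hK.isClosed.preimage hcont) ?_
    exact (Set.preimage_mono hKV).trans ((hle V).trans subset_closure)
  refine ⟨f, ⟨hskel, (isPerfectMap_iff_isProperMap f).2 hprop⟩, ?_⟩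
  ext V : 1
  apply SetLike.coe_injective
  rw [coe_pullback, hφ]

end RegionBased

namespace RegionBased

open TopologicalSpace

/-! ### The space of ends of a complete MVD-algebra -/

/-- The type of ends of a complete MVD-algebra. -/
def CMVD.Ends (A : CMVD.{u}) : Type u := {E : Set A.carrier // IsEnd A.ll E}

namespace CMVD

variable {A : CMVD.{u}}

/-- The basic open set of ends containing `a`. -/
def basicOpen (a : A.carrier) : Set A.Ends := {E | a ∈ E.1}

instance : TopologicalSpace A.Ends := generateFrom (Set.range basicOpen)

theorem basicOpen_inf (a b : A.carrier) :
    (basicOpen (a ⊓ b) : Set A.Ends) = basicOpen a ∩ basicOpen b := by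
  ext E
  exact ⟨fun h => ⟨E.2.mem_of_le _ _ inf_le_left h, E.2.mem_of_le _ _ inf_le_right h⟩,
    fun h => E.2.inf_mem _ _ h.1 h.2⟩

theorem basicOpen_mono {a b : A.carrier} (h : a ≤ b) :
    (basicOpen a : Set A.Ends) ⊆ basicOpen b :=
  fun E hE => E.2.mem_of_le _ _ h hE

theorem isTopologicalBasis_basicOpen :
    IsTopologicalBasis (Set.range (basicOpen : A.carrier → Set A.Ends)) where
  exists_subset_inter := by
    rintro _ ⟨a, rfl⟩ _ ⟨b, rfl⟩ E hE
    exact ⟨_, ⟨a ⊓ b, rfl⟩, by rwa [basicOpen_inf], (basicOpen_inf a b).subset⟩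
  sUnion_eq := Set.eq_univ_of_forall fun E => ⟨_, ⟨⊤, rfl⟩, E.2.top_mem⟩
  eq_generateFrom := rfl

theorem isOpen_basicOpen (a : A.carrier) : IsOpen (basicOpen a : Set A.Ends) :=
  isTopologicalBasis_basicOpen.isOpen ⟨a, rfl⟩

theorem basicOpen_nonempty {a : A.carrier} (ha : a ≠ ⊥) : (basicOpen a : Set A.Ends).Nonempty := by
  obtain ⟨E, hE, haE⟩ := A.isMVD.exists_isEnd ha
  exact ⟨⟨E, hE⟩, haE⟩

theorem disjoint_basicOpen_iff {a b : A.carrier} :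
    Disjoint (basicOpen a : Set A.Ends) (basicOpen b) ↔ Disjoint a b := by
  rw [Set.disjoint_iff_inter_eq_empty, ← basicOpen_inf, disjoint_iff]
  refine ⟨fun h => ?_, fun h => ?_⟩
  · by_contra hn
    exact (basicOpen_nonempty hn).ne_empty h
  · rw [h]
    exact Set.eq_empty_of_forall_notMem fun E hE => E.2.bot_notMem hE

/-- A basic neighbourhood missing `basicOpen a` has index below `aᶜ`, because every non-zero element
lies in an end. Hence basic open sets are regular open, with complements computed in `A`. -/
theorem mem_closure_basicOpen {a : A.carrier} {E : A.Ends} :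
    E ∈ closure (basicOpen a) ↔ aᶜ ∉ E.1 := by
  refine ⟨fun hE ha => ?_, fun ha => ?_⟩
  · obtain ⟨F, hF1, hF2⟩ := mem_closure_iff.1 hE (basicOpen aᶜ) (isOpen_basicOpen _) ha
    exact F.2.compl_notMem hF2 hF1
  · rw [isTopologicalBasis_basicOpen.mem_closure_iff]
    rintro _ ⟨b, rfl⟩ hb
    by_contra hn
    have hd := disjoint_basicOpen_iff.1
      (Set.disjoint_iff_inter_eq_empty.2 (Set.not_nonempty_iff_eq_empty.1 hn))
    exact ha (E.2.mem_of_le _ _ (le_compl_iff_disjoint_right.2 hd) hb)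

theorem compl_closure_basicOpen (a : A.carrier) :
    (closure (basicOpen a : Set A.Ends))ᶜ = basicOpen aᶜ := by
  ext E
  rw [Set.mem_compl_iff, mem_closure_basicOpen, not_not]
  rfl

theorem interior_closure_basicOpen (a : A.carrier) :
    interior (closure (basicOpen a : Set A.Ends)) = basicOpen a := by
  rw [interior_eq_compl_closure_compl, compl_closure_basicOpen, compl_closure_basicOpen,
    compl_compl]

theorem closure_basicOpen_subset {a b : A.carrier} (h : A.ll a b) :
    closure (basicOpen a : Set A.Ends) ⊆ basicOpen b :=
  fun E hE => (E.2.compl_mem_or a b h).resolve_left (mem_closure_basicOpen.1 hE)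

/-- The limit of an ultrafilter of ends containing a bounded basic open set. -/
theorem isEnd_limit (𝒰 : Ultrafilter A.Ends) {b : A.carrier} (hb : A.ll b ⊤)
    (h𝒰 : basicOpen b ∈ 𝒰) : IsEnd A.ll {y | ∃ x, A.ll x y ∧ basicOpen x ∈ 𝒰} := by
  have hinf : ∀ x y : A.carrier, basicOpen x ∈ 𝒰 → basicOpen y ∈ 𝒰 → basicOpen (x ⊓ y) ∈ 𝒰 := by
    intro x y hx hy
    rw [basicOpen_inf]
    exact Filter.inter_mem hx hy
  refine ⟨⟨⟨b, hb, h𝒰⟩, ?_, ?_, ?_, ?_⟩, ?_⟩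
  · rintro ⟨x, hx, hx𝒰⟩
    obtain ⟨E, hE⟩ := 𝒰.nonempty_of_mem hx𝒰
    exact E.2.bot_notMem (E.2.mem_of_le _ _ (A.isMVD.le_of_ll _ _ hx) hE)
  · rintro y z hyz ⟨x, hx, hx𝒰⟩
    exact ⟨x, A.isMVD.mono _ _ _ _ le_rfl hx hyz, hx𝒰⟩
  · rintro y z ⟨x, hx, hx𝒰⟩ ⟨w, hw, hw𝒰⟩
    exact ⟨x ⊓ w, A.isMVD.inf_ll_inf hx hw, hinf _ _ hx𝒰 hw𝒰⟩
  · rintro y ⟨x, hx, hx𝒰⟩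
    obtain ⟨z, hxz, hzy⟩ := A.isMVD.interpolate _ _ hx
    exact ⟨z, ⟨x, hxz, hx𝒰⟩, hzy⟩
  · intro c d hcd
    -- The ultrafilter decides `c₂`. In the negative case it contains `basicOpen c₁ᶜ`, because `c₁ ≪
    -- c₂`; meeting with `b` makes the witness bounded.
    obtain ⟨c₂, hc₂, hd⟩ := A.isMVD.interpolate _ _ hcd
    obtain ⟨c₁, hc₁, hc₁₂⟩ := A.isMVD.interpolate _ _ hc₂
    rcases 𝒰.mem_or_compl_mem (basicOpen c₂) with h | h
    · exact Or.inr ⟨c₂, hd, h⟩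
    · refine Or.inl ⟨c₁ᶜ ⊓ b, A.isMVD.compl_inf_ll_compl hc₁ hb, hinf _ _ ?_ h𝒰⟩
      refine Filter.mem_of_superset h ?_
      rw [← compl_closure_basicOpen]
      exact Set.compl_subset_compl.2 (closure_basicOpen_subset hc₁₂)

/-- With `a ≪ b ≪ ⊤`, an ultrafilter on the closure contains `basicOpen b`, so it converges to the
end of `isEnd_limit`. -/
theorem isCompact_closure_basicOpen {a : A.carrier} (ha : A.ll a ⊤) :
    IsCompact (closure (basicOpen a : Set A.Ends)) := by
  obtain ⟨b, hab, hb⟩ := A.isMVD.interpolate _ _ ha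
  rw [isCompact_iff_ultrafilter_le_nhds]
  intro 𝒰 h𝒰
  have ha𝒰 : closure (basicOpen a) ∈ 𝒰 := Filter.le_principal_iff.1 h𝒰
  have hE := isEnd_limit 𝒰 hb (Filter.mem_of_superset ha𝒰 (closure_basicOpen_subset hab))
  have hlim : (𝒰 : Filter A.Ends) ≤ nhds ⟨_, hE⟩ := by
    intro s hs
    obtain ⟨_, ⟨y, rfl⟩, ⟨x, hxy, hx⟩, hys⟩ := isTopologicalBasis_basicOpen.mem_nhds_iff.1 hs
    exact Filter.mem_of_superset hx ((basicOpen_mono (A.isMVD.le_of_ll _ _ hxy)).trans hys)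
  exact ⟨_, isClosed_iff_ultrafilter.1 isClosed_closure _ 𝒰 hlim ha𝒰, hlim⟩

instance : T2Space A.Ends := by
  refine ⟨fun E F hne => ?_⟩
  have hnot : ¬ E.1 ⊆ F.1 := fun h =>
    hne (Subtype.ext (E.2.eq_of_subset F.2.toIsRoundFilter h))
  obtain ⟨b, hbE, hbF⟩ := Set.not_subset.1 hnot
  obtain ⟨a, haE, hab⟩ := E.2.exists_ll b hbE
  exact ⟨basicOpen a, basicOpen aᶜ, isOpen_basicOpen _, isOpen_basicOpen _, haE,
    (F.2.compl_mem_or a b hab).resolve_right hbF, disjoint_basicOpen_iff.2 disjoint_compl_right⟩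

instance : LocallyCompactSpace A.Ends := by
  refine ⟨fun E s hs => ?_⟩
  obtain ⟨_, ⟨b, rfl⟩, hb, hbs⟩ := isTopologicalBasis_basicOpen.mem_nhds_iff.1 hs
  obtain ⟨a, ha, hab⟩ := E.2.exists_ll b hb
  exact ⟨closure (basicOpen a),
    Filter.mem_of_superset ((isOpen_basicOpen a).mem_nhds ha) subset_closure,
    (closure_basicOpen_subset hab).trans hbs, isCompact_closure_basicOpen (A.isMVD.ll_top hab)⟩

/-- The space of ends of a complete MVD-algebra. -/
def spec (A : CMVD.{u}) : LCHaus.{u} := ⟨A.Ends⟩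

/-- The regular open set of ends containing `a`. -/
def basicRO (a : A.carrier) : RO A.Ends := RO.mk (basicOpen a)

theorem coe_basicRO (a : A.carrier) : (basicRO a : Set A.Ends) = basicOpen a := by
  rw [basicRO, RO.coe_mk, interior_closure_basicOpen]

theorem basicRO_le_iff {a b : A.carrier} : (basicRO a : RO A.Ends) ≤ basicRO b ↔ a ≤ b := by
  rw [RO.le_iff, coe_basicRO, coe_basicRO]
  refine ⟨fun h => ?_, basicOpen_mono⟩
  rw [← disjoint_compl_right_iff, ← disjoint_basicOpen_iff]
  exact (disjoint_basicOpen_iff.2 disjoint_compl_right).mono_left h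

theorem basicOpen_sSup_subset (S : Set A.carrier) :
    (basicOpen (sSup S) : Set A.Ends) ⊆ closure (⋃ a ∈ S, basicOpen a) := by
  intro E hE
  rw [isTopologicalBasis_basicOpen.mem_closure_iff]
  rintro _ ⟨b, rfl⟩ hb
  by_contra hn
  have hd : sSup S ≤ bᶜ := sSup_le fun a ha => by
    rw [le_compl_iff_disjoint_left, ← disjoint_basicOpen_iff, Set.disjoint_iff_inter_eq_empty]
    refine Set.not_nonempty_iff_eq_empty.1 fun hne => hn (hne.mono ?_)
    exact Set.inter_subset_inter_right _ (Set.subset_biUnion_of_mem ha)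
  exact E.2.compl_notMem hb (E.2.mem_of_le _ _ hd hE)

/-- Completeness of `A` supplies the preimage: the join of all indices of basic open sets inside
`W`. -/
theorem basicRO_surjective : Function.Surjective (basicRO : A.carrier → RO A.Ends) := by
  intro W
  refine ⟨sSup {a | (basicOpen a : Set A.Ends) ⊆ W}, le_antisymm ?_ ?_⟩
  · rw [RO.le_iff_subset_closure, coe_basicRO]
    exact (basicOpen_sSup_subset _).trans (closure_mono (Set.iUnion₂_subset fun a ha => ha))
  · rw [RO.le_iff, coe_basicRO]
    intro E hE
    obtain ⟨_, ⟨a, rfl⟩, ha, haW⟩ :=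
      isTopologicalBasis_basicOpen.mem_nhds_iff.1 (W.isOpen.mem_nhds hE)
    exact basicOpen_mono (le_sSup haW) ha

/-- For the forward direction, each end in the compact closure contains some `c ≪ b`. Finitely many
such `basicOpen c` cover it, and the join of these `c` is still `≪ b`. -/
theorem roLL_basicRO_iff {a b : A.carrier} :
    roLL (basicRO a : RO A.Ends) (basicRO b) ↔ A.ll a b := by
  rw [roLL, coe_basicRO, coe_basicRO]
  refine ⟨fun h => ?_, fun h =>
    ⟨isCompact_closure_basicOpen (A.isMVD.ll_top h), closure_basicOpen_subset h⟩⟩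
  have key : ∃ c, A.ll c b ∧ closure (basicOpen a : Set A.Ends) ⊆ basicOpen c := by
    refine h.1.induction_on (p := fun s => ∃ c, A.ll c b ∧ s ⊆ (basicOpen c : Set A.Ends))
      ⟨⊥, A.isMVD.bot_ll' b, Set.empty_subset _⟩
      (fun s t hst ⟨c, hc, htc⟩ => ⟨c, hc, hst.trans htc⟩)
      (fun s t ⟨c, hc, hsc⟩ ⟨d, hd, htd⟩ => ⟨c ⊔ d, A.isMVD.sup_ll _ _ _ hc hd,
        Set.union_subset (hsc.trans (basicOpen_mono le_sup_left))
          (htd.trans (basicOpen_mono le_sup_right))⟩) fun E hE => ?_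
    obtain ⟨c, hcE, hcb⟩ := E.2.exists_ll b (h.2 hE)
    exact ⟨basicOpen c, mem_nhdsWithin_of_mem_nhds ((isOpen_basicOpen c).mem_nhds hcE),
      c, hcb, le_rfl⟩
  obtain ⟨c, hcb, hac⟩ := key
  refine A.isMVD.mono _ _ _ _ ?_ hcb le_rfl
  rw [← basicRO_le_iff, RO.le_iff, coe_basicRO, coe_basicRO]
  exact subset_closure.trans hac

/-- A complete MVD-algebra is isomorphic to the algebra of regular open sets of ends. -/
noncomputable def basicROIso (A : CMVD.{u}) : A.carrier ≃o RO A.Ends :=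
  RelIso.ofSurjective (OrderEmbedding.ofMapLEIff basicRO fun _ _ => basicRO_le_iff)
    basicRO_surjective

end CMVD

/-! ### Isomorphisms of complete MVD-algebras -/

/-- An order isomorphism as a complete Boolean homomorphism. -/
abbrev ofIso {A B : Type u} [CompleteBooleanAlgebra A] [CompleteBooleanAlgebra B] (e : A ≃o B) :
    CompleteLatticeHom A B :=
  CompleteLatticeHom.OrderIso.toCompleteLatticeHom e

theorem lowerAdj_orderIso {A B : Type u} [CompleteBooleanAlgebra A] [CompleteBooleanAlgebra B]
    (e : A ≃o B) (b : B) : lowerAdj (ofIso e) b = e.symm b :=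
  eq_of_forall_ge_iff fun a => (gc_lowerAdj (ofIso e) b a).trans e.symm_apply_le.symm

theorem isIA_orderIso {A B : CMVD.{u}} (e : A.carrier ≃o B.carrier)
    (he : ∀ a b, B.ll (e a) (e b) ↔ A.ll a b) : IsIA (ofIso e) where
  es1 a b h := (he a b).2 h
  s2 b hb := by
    rw [lowerAdj_orderIso, ← he, e.apply_symm_apply, map_top]
    exact hb
  s3 a ha := by
    have := (he a ⊤).2 ha
    rwa [map_top] at this

theorem condCS_orderIso {A B : CMVD.{u}} (e : A.carrier ≃o B.carrier)
    (he : ∀ a b, B.ll (e a) (e b) ↔ A.ll a b) : CondCS (ofIso e) := by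
  intro a b h
  rw [lowerAdj_orderIso, lowerAdj_orderIso, ← map_compl' e.symm, compl_compl, ← he,
    e.apply_symm_apply, e.apply_symm_apply]
  exact h

theorem orderIso_symm_comp {A B : Type u} [CompleteBooleanAlgebra A]
    [CompleteBooleanAlgebra B] (e : A ≃o B) :
    (ofIso e.symm).comp (ofIso e) = CompleteLatticeHom.id A := by
  ext a
  exact e.symm_apply_apply a

/-- Order isomorphisms preserving and reflecting `≪` are isomorphisms in `IIA`. -/
def IIA.mkIso {A B : IIA.{u}} (e : A.carrier ≃o B.carrier)
    (he : ∀ a b, B.ll (e a) (e b) ↔ A.ll a b) : A ≅ B where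
  hom := IIA.Hom.mk (ofIso e) e.injective (isIA_orderIso (A := A.toCMVD) (B := B.toCMVD) e he)
  inv := IIA.Hom.mk (ofIso e.symm) e.symm.injective
    (isIA_orderIso (A := B.toCMVD) (B := A.toCMVD) e.symm fun a b => by
      rw [← he, e.apply_symm_apply, e.apply_symm_apply])
  hom_inv_id := IIA.Hom.ext (orderIso_symm_comp e)
  inv_hom_id := IIA.Hom.ext (orderIso_symm_comp e.symm)

/-- Order isomorphisms preserving and reflecting `≪` are isomorphisms in `SIA`. -/
def SIA.mkIso {A B : SIA.{u}} (e : A.carrier ≃o B.carrier)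
    (he : ∀ a b, B.ll (e a) (e b) ↔ A.ll a b) : A ≅ B :=
  have he' : ∀ a b, A.ll (e.symm a) (e.symm b) ↔ B.ll a b := fun a b => by
    rw [← he, e.apply_symm_apply, e.apply_symm_apply]
  { hom := SIA.Hom.mk (ofIso e) (isIA_orderIso (A := A.toCMVD) (B := B.toCMVD) e he)
      (condCS_orderIso (A := A.toCMVD) (B := B.toCMVD) e he)
    inv := SIA.Hom.mk (ofIso e.symm) (isIA_orderIso (A := B.toCMVD) (B := A.toCMVD) e.symm he')
      (condCS_orderIso (A := B.toCMVD) (B := A.toCMVD) e.symm he')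
    hom_inv_id := SIA.Hom.ext (orderIso_symm_comp e)
    inv_hom_id := SIA.Hom.ext (orderIso_symm_comp e.symm) }

/-! ### The dual equivalences -/

/-- The contravariant functor of regular open sets on surjective skeletal perfect maps. -/
def regularOpenIIA : SSLC.{u}ᵒᵖ ⥤ IIA.{u} where
  obj X := ⟨X.unop.toLCHaus.toCMVD⟩
  map f := IIA.Hom.mk (pullback (SSLC.Hom.isSkelPerfect f.unop).isSkeletal
      (SSLC.Hom.isSkelPerfect f.unop).isPerfectMap.continuous)
    (pullback_injective _ _ (SSLC.Hom.surjective f.unop)) (SSLC.Hom.isSkelPerfect f.unop).isIA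
  map_id X :=
    have h := IsSkelPerfect.id X.unop.carrier
    IIA.Hom.ext (pullback_id h.isSkeletal h.isPerfectMap.continuous)
  map_comp f g :=
    have hf := SSLC.Hom.isSkelPerfect f.unop
    have hg := SSLC.Hom.isSkelPerfect g.unop
    IIA.Hom.ext (pullback_comp hg.isSkeletal hg.isPerfectMap.continuous hf.isSkeletal
      hf.isPerfectMap.continuous (hf.comp hg).isSkeletal (hf.comp hg).isPerfectMap.continuous)

/-- The contravariant functor of regular open sets on injective skeletal perfect maps. -/
def regularOpenSIA : ISLC.{u}ᵒᵖ ⥤ SIA.{u} where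
  obj X := ⟨X.unop.toLCHaus.toCMVD⟩
  map f := SIA.Hom.mk (pullback (ISLC.Hom.isSkelPerfect f.unop).isSkeletal
      (ISLC.Hom.isSkelPerfect f.unop).isPerfectMap.continuous)
    (ISLC.Hom.isSkelPerfect f.unop).isIA
    ((ISLC.Hom.isSkelPerfect f.unop).condCS (ISLC.Hom.injective f.unop))
  map_id X :=
    have h := IsSkelPerfect.id X.unop.carrier
    SIA.Hom.ext (pullback_id h.isSkeletal h.isPerfectMap.continuous)
  map_comp f g :=
    have hf := ISLC.Hom.isSkelPerfect f.unop
    have hg := ISLC.Hom.isSkelPerfect g.unop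
    SIA.Hom.ext (pullback_comp hg.isSkeletal hg.isPerfectMap.continuous hf.isSkeletal
      hf.isPerfectMap.continuous (hf.comp hg).isSkeletal (hf.comp hg).isPerfectMap.continuous)

instance : regularOpenIIA.{u}.Faithful where
  map_injective {_ _ f g} h :=
    have hf := SSLC.Hom.isSkelPerfect f.unop
    have hg := SSLC.Hom.isSkelPerfect g.unop
    Quiver.Hom.unop_inj (SSLC.Hom.ext
      (eq_of_pullback_eq hf.isSkeletal hf.isPerfectMap.continuous hg.isSkeletal
        hg.isPerfectMap.continuous (congrArg IIA.Hom.map h)))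

instance : regularOpenSIA.{u}.Faithful where
  map_injective {_ _ f g} h :=
    have hf := ISLC.Hom.isSkelPerfect f.unop
    have hg := ISLC.Hom.isSkelPerfect g.unop
    Quiver.Hom.unop_inj (ISLC.Hom.ext
      (eq_of_pullback_eq hf.isSkeletal hf.isPerfectMap.continuous hg.isSkeletal
        hg.isPerfectMap.continuous (congrArg SIA.Hom.map h)))

instance : regularOpenIIA.{u}.Full where
  map_surjective {X Y} φ := by
    obtain ⟨f, hf, h⟩ := IsIA.exists_map (X := Y.unop.toLCHaus) (Y := X.unop.toLCHaus)
      (IIA.Hom.isIA φ)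
    have hs : Function.Surjective f :=
      surjective_of_pullback_injective hf.isSkeletal hf.isPerfectMap.continuous
        hf.isPerfectMap.isClosedMap (by rw [h]; exact IIA.Hom.injective φ)
    exact ⟨Quiver.Hom.op (SSLC.Hom.mk f hs hf), IIA.Hom.ext h⟩

instance : regularOpenSIA.{u}.Full where
  map_surjective {X Y} φ := by
    obtain ⟨f, hf, h⟩ := IsIA.exists_map (X := Y.unop.toLCHaus) (Y := X.unop.toLCHaus)
      (SIA.Hom.isIA φ)
    have hi : Function.Injective f :=
      injective_of_condCS (X := Y.unop.toLCHaus) (Y := X.unop.toLCHaus) hf.isSkeletal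
        hf.isPerfectMap.continuous (by rw [h]; exact SIA.Hom.condCS φ)
    exact ⟨Quiver.Hom.op (ISLC.Hom.mk f hi hf), SIA.Hom.ext h⟩

instance : regularOpenIIA.{u}.EssSurj where
  mem_essImage A := ⟨Opposite.op ⟨A.toCMVD.spec⟩,
    ⟨(IIA.mkIso (A := A) (B := regularOpenIIA.obj (Opposite.op ⟨A.toCMVD.spec⟩))
      A.toCMVD.basicROIso fun _ _ => CMVD.roLL_basicRO_iff).symm⟩⟩

instance : regularOpenSIA.{u}.EssSurj where
  mem_essImage A := ⟨Opposite.op ⟨A.toCMVD.spec⟩,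
    ⟨(SIA.mkIso (A := A) (B := regularOpenSIA.obj (Opposite.op ⟨A.toCMVD.spec⟩))
      A.toCMVD.basicROIso fun _ _ => CMVD.roLL_basicRO_iff).symm⟩⟩

instance : regularOpenIIA.{u}.IsEquivalence where

instance : regularOpenSIA.{u}.IsEquivalence where

end RegionBased

theorem mainTheorem6 :
    (RegionBased.IsomorphicCategories RegionBased.ISAL.{u} RegionBased.IIA.{u} ∧
      RegionBased.DuallyEquivalent RegionBased.SSLC.{u} RegionBased.IIA.{u}) ∧
    (RegionBased.IsomorphicCategories RegionBased.SSAL.{u} RegionBased.SIA.{u} ∧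
      RegionBased.DuallyEquivalent RegionBased.ISLC.{u} RegionBased.SIA.{u}) :=
  ⟨⟨RegionBased.isomorphic_ISAL_IIA, ⟨RegionBased.regularOpenIIA.asEquivalence⟩⟩,
    RegionBased.isomorphic_SSAL_SIA, ⟨RegionBased.regularOpenSIA.asEquivalence⟩⟩
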